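/- Throughout, systems are finite-dimensional and nonzero, and superoperators are linear maps between spaces of operators. A quantum instrument from $A$ to $A'$ is a countable family $(\mathcal E_i)_i$ of completely positive maps whose sum is trace-preserving. For a set $Q$ of instruments let $$S[Q]=\Big\{\sum_i\beta_i\mathcal E_i \;\Big|\; (\mathcal E_i)_i\in Q,\ \beta_i\in[-1,1]\Big\}.$$ Let $\mathrm{LO}^\star(A;B)=S[Q_{\mathrm{LO}}]$, where $Q_{\mathrm{LO}}$ is the set of instruments $(\mathcal E_i\otimes\mathcal F_j)_{i,j}$ with $(\mathcal E_i)_i$ an instrument on $A$ and $(\mathcal F_j)_j$ an instrument on $B$. Let $\mathrm{LOCC}^\star(A;B)=S[Q_{\mathrm{LOCC}}]$, where $Q_{\mathrm{LOCC}}$ is the set of LOCC instruments on $A;B$. In detail: a one-way local instrument is an instrument $(\mathcal E_i\otimes\mathcal T_i)_i$ or $(\mathcal T_i\otimes\mathcal E_i)_i$, with $(\mathcal E_i)_i$ an instrument of one party and $\mathcal T_i$ channels of the other. An instrument is LOCC-linked to $(\mathcal G_i)_i$ if it is obtained by performing, after outcome $i$, a one-way local instrument depending on $i$, followed by a merging of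 outcomes. A finite-round LOCC instrument arises from a one-way local instrument, with outcomes merged, by finitely many such links; local memories of any finite dimension are allowed. An instrument is LOCC if there is a sequence $(\mathfrak P_\nu)_\nu$ of finite-round LOCC instruments, each linked to its predecessor, such that local channels into the output systems (depending on the outcome) and a merging of outcomes turn $\mathfrak P_\nu$ into an instrument $\mathfrak I_\nu$, and $\mathfrak I_\nu$ converges to the given instrument as $\nu\to\infty$ (in the diamond norm of the associated measurement channels). For a set $S$ of superoperators, the quasiprobability extent is $$\gamma_S(\mathcal E)=\inf\Big\{\sum_{i=1}^m|a_i| \;\Big|\; m\ge 1,\ \mathcal E=\sum_{i=1}^m a_i\mathcal F_i,\ \mathcal F_i\in S,\ a_i\in\mathbb R\Big\}\in[0,\infty],$$ with $\inf\emptyset=\infty$. **Theorem.** Let $U$ be a unitary operator on $A\otimes B$ with an operator Schmidt decomposition $U=\sum_j u_j\,L_j\otimes R_j$, that is, a finite sum with $u_j>0$, $\frac1{\dim A}\mathrm{tr}[L_j^\dagger L_k]=\delta_{jk}$ and $\frac1{\dim B}\mathrm{tr}[R_j^\dagger R_k]=\delta_{jk}$. Suppose that all $L_j$ and all $R_j$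 are unitary. Then the induced channel $\mathcal U(X)=UXU^\dagger$ satisfies $$\gamma_{\mathrm{LOCC}^\star(A;B)}(\mathcal U)=\gamma_{\mathrm{LO}^\star(A;B)}(\mathcal U)=2\Big(\sum_j u_j\Big)^2-1 .$$ Moreover, every unitary $U$ on $\mathbb C^2\otimes\mathbb C^2$ has an operator Schmidt decomposition $U=\sum_j u_jL_j\otimes R_j$ in which all $L_j$ and $R_j$ are unitary. -/

import Mathlib

open Filter Topology
open scoped Kronecker ComplexOrder ENNReal

/-- Linear superoperators from the system `A` to the system `B`.  A finite-dimensional quantum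
system is given by a finite index set of an orthonormal basis; the joint system is the product. -/
abbrev SuperOp (A B : Type*) := Matrix A A ℂ →ₗ[ℂ] Matrix B B ℂ

/-- The superoperator `X ↦ U X U†` induced by an operator `U`. -/
def inducedMap {A B : Type*} [Fintype A] (U : Matrix B A ℂ) : SuperOp A B where
  toFun X := U * X * U.conjTranspose
  map_add' X Y := by rw [Matrix.mul_add, Matrix.add_mul]
  map_smul' c X := by simp

/-- The tensor product `E ⊗ F` of two superoperators, i.e. the linear extension of
`X ⊗ Y ↦ E X ⊗ F Y` (see `tensorMap_kronecker`). -/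
noncomputable def tensorMap {A B A' B' : Type*} [Fintype A] [DecidableEq A] [Fintype B]
    [DecidableEq B] (E : SuperOp A A') (F : SuperOp B B') : SuperOp (A × B) (A' × B') where
  toFun X := ∑ a, ∑ c, ∑ b, ∑ d,
    X (a, b) (c, d) • (E (Matrix.single a c 1) ⊗ₖ F (Matrix.single b d 1))
  map_add' X Y := by simp [add_smul, Finset.sum_add_distrib]
  map_smul' r X := by simp [Finset.smul_sum, smul_smul]

theorem tensorMap_kronecker {A B A' B' : Type*} [Fintype A] [DecidableEq A] [Fintype B]
    [DecidableEq B] (E : SuperOp A A') (F : SuperOp B B') (X : Matrix A A ℂ)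
    (Y : Matrix B B ℂ) : tensorMap E F (X ⊗ₖ Y) = E X ⊗ₖ F Y := by
  have hX : E X = ∑ a, ∑ c, X a c • E (Matrix.single a c 1) := by
    conv_lhs => rw [Matrix.matrix_eq_sum_single X]
    simp only [map_sum, ← map_smul, Matrix.smul_single, smul_eq_mul, mul_one]
  have hY : F Y = ∑ b, ∑ d, Y b d • F (Matrix.single b d 1) := by
    conv_lhs => rw [Matrix.matrix_eq_sum_single Y]
    simp only [map_sum, ← map_smul, Matrix.smul_single, smul_eq_mul, mul_one]
  have h : E X ⊗ₖ F Y = ∑ a, ∑ c, ∑ b, ∑ d, (X a c * Y b d) •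
      (E (Matrix.single a c 1) ⊗ₖ F (Matrix.single b d 1)) := by
    ext p q
    rw [hX, hY]
    simp only [Matrix.kroneckerMap_apply, Matrix.sum_apply, Matrix.smul_apply, smul_eq_mul,
      Finset.sum_mul]
    refine Finset.sum_congr rfl fun a _ => Finset.sum_congr rfl fun c _ => ?_
    simp only [Finset.mul_sum]
    refine Finset.sum_congr rfl fun b _ => Finset.sum_congr rfl fun d _ => ?_
    ring
  rw [h]
  rfl

/-- Complete positivity: `Φ ⊗ id_E` preserves positive semidefiniteness for every system `E`. -/
def IsCP {A B : Type*} [Fintype A] [DecidableEq A] (Φ : SuperOp A B) : Prop :=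
  ∀ (k : ℕ) (ρ : Matrix (A × Fin k) (A × Fin k) ℂ), ρ.PosSemidef →
    (tensorMap Φ (LinearMap.id : SuperOp (Fin k) (Fin k)) ρ).PosSemidef

/-- Trace preservation. -/
def IsTP {A B : Type*} [Fintype A] [Fintype B] (Φ : SuperOp A B) : Prop :=
  ∀ ω, (Φ ω).trace = ω.trace

/-- Quantum channels. -/
def IsChannel {A B : Type*} [Fintype A] [DecidableEq A] [Fintype B] (Φ : SuperOp A B) : Prop :=
  IsCP Φ ∧ IsTP Φ

/-- A quantum instrument from `A` to `B`: a countable family of completely positive maps whose sum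
is trace-preserving.  (Zero members are permitted; they do not affect any decomposition set.) -/
structure QInstrument (A B : Type*) [Fintype A] [DecidableEq A] [Fintype B] where
  /-- the set of classical outcomes -/
  Θ : Type
  countable : Countable Θ
  /-- the maps of the instrument -/
  map : Θ → SuperOp A B
  isCP : ∀ i, IsCP (map i)
  sum_isTP : ∃ Φ : SuperOp A B, (∀ ω, HasSum (fun i => map i ω) (Φ ω)) ∧ IsTP Φ

/-- The decomposition set of a set `Q` of instruments: all `∑ᵢ βᵢ Eᵢ` with `(Eᵢ)ᵢ ∈ Q` and
`βᵢ ∈ [-1, 1]`. -/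
def decompositionSet {A B : Type*} [Fintype A] [DecidableEq A] [Fintype B]
    (Q : Set (QInstrument A B)) : Set (SuperOp A B) :=
  {F | ∃ I ∈ Q, ∃ β : I.Θ → ℝ, (∀ i, β i ∈ Set.Icc (-1 : ℝ) 1) ∧
    ∀ ω, HasSum (fun i => (β i : ℂ) • I.map i ω) (F ω)}

/-- The quasiprobability extent of `E` with respect to a decomposition set `S`: the infimum of the
1-norms of the decompositions `E = ∑ᵢ aᵢ Fᵢ` with `Fᵢ ∈ S`, and `∞` if there are none. -/
noncomputable def quasiprobExtent {A B : Type*} (S : Set (SuperOp A B)) (E : SuperOp A B) :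
    ℝ≥0∞ :=
  sInf {x | ∃ m : ℕ, 1 ≤ m ∧ ∃ (a : Fin m → ℝ) (F : Fin m → SuperOp A B),
    (∀ i, F i ∈ S) ∧ E = ∑ i, (a i : ℂ) • F i ∧ x = ENNReal.ofReal (∑ i, |a i|)}

/-- The instruments of local operations `(Eᵢ ⊗ Fⱼ)ᵢⱼ`, for instruments `(Eᵢ)ᵢ` on the first and
`(Fⱼ)ⱼ` on the second party. -/
def loInstruments (A B A' B' : Type*) [Fintype A] [DecidableEq A] [Fintype B] [DecidableEq B]
    [Fintype A'] [Fintype B'] : Set (QInstrument (A × B) (A' × B')) :=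
  {I | ∃ (E : QInstrument A A') (F : QInstrument B B') (e : I.Θ ≃ E.Θ × F.Θ),
    ∀ i, I.map i = tensorMap (E.map (e i).1) (F.map (e i).2)}

/-- `LO⋆(A;B → A';B')`. -/
def LOStar (A B A' B' : Type*) [Fintype A] [DecidableEq A] [Fintype B] [DecidableEq B]
    [Fintype A'] [Fintype B'] : Set (SuperOp (A × B) (A' × B')) :=
  decompositionSet (loInstruments A B A' B')

/-- `I'` is a coarse-graining of `I`: outcomes of `I` are merged along a map `f`. -/
def IsCoarseGraining {A B ι κ : Type*} (I : ι → SuperOp A B) (I' : κ → SuperOp A B) : Prop :=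
  ∃ f : ι → κ, ∀ k ω, HasSum (fun i : {i // f i = k} => I i ω) (I' k ω)

/-- One-way local instruments: one party performs an instrument and announces the outcome `i`, the
other party then applies a channel depending on `i`. -/
def IsOneWayLocal {A B A' B' : Type*} [Fintype A] [DecidableEq A] [Fintype B] [DecidableEq B]
    [Fintype A'] [Fintype B'] {ι : Type} (I : ι → SuperOp (A × B) (A' × B')) : Prop :=
  (∃ (E : QInstrument A A') (e : ι ≃ E.Θ) (T : ι → SuperOp B B'),
    (∀ i, IsChannel (T i)) ∧ ∀ i, I i = tensorMap (E.map (e i)) (T i)) ∨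
  (∃ (F : QInstrument B B') (e : ι ≃ F.Θ) (T : ι → SuperOp A A'),
    (∀ i, IsChannel (T i)) ∧ ∀ i, I i = tensorMap (T i) (F.map (e i)))

/-- `I'` is LOCC-linked to `I`: after the outcome `i` of `I`, a one-way local instrument `K i`
(with the acting party chosen depending on `i`) is performed, and the result is coarse-grained. -/
def IsLOCCLinked {A B C D C' D' : Type*} [Fintype C] [DecidableEq C] [Fintype D] [DecidableEq D]
    [Fintype C'] [Fintype D'] {ι κ : Type} (I : ι → SuperOp (A × B) (C × D))
    (I' : κ → SuperOp (A × B) (C' × D')) : Prop :=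
  ∃ (μ : ι → Type) (K : ∀ i, μ i → SuperOp (C × D) (C' × D')),
    (∀ i, IsOneWayLocal (K i)) ∧
    IsCoarseGraining (fun p : (Σ i, μ i) => (K p.1 p.2).comp (I p.1)) I'

/-- Families implemented by LOCC protocols with finitely many rounds.  The local systems held after
a round may have any finite dimensions `a` and `b`. -/
inductive IsFiniteLOCC {A B : Type*} [Fintype A] [DecidableEq A] [Fintype B] [DecidableEq B] :
    ∀ {a b : ℕ} {ι : Type}, (ι → SuperOp (A × B) (Fin a × Fin b)) → Prop
  | one {a b : ℕ} {ι κ : Type} (I : ι → SuperOp (A × B) (Fin a × Fin b))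
      (I' : κ → SuperOp (A × B) (Fin a × Fin b)) :
      Countable κ → IsOneWayLocal I → IsCoarseGraining I I' → IsFiniteLOCC I'
  | link {a b a' b' : ℕ} {ι κ : Type} (I : ι → SuperOp (A × B) (Fin a × Fin b))
      (I' : κ → SuperOp (A × B) (Fin a' × Fin b')) :
      Countable κ → IsFiniteLOCC I → IsLOCCLinked I I' → IsFiniteLOCC I'

/-- The distance of two families with the same outcomes: the sum over the outcomes of the entrywise
`ℓ¹`-distance of the Choi matrices.  On instruments between fixed finite-dimensional systems it is
equivalent, with constants independent of the number of outcomes, to the diamond-norm distance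
of the measurement channels `∑ₖ Eₖ ⊗ |k⟩⟨k|`. -/
noncomputable def instrumentDist {A B κ : Type*} [Fintype A] [DecidableEq A] [Fintype B]
    (I I' : κ → SuperOp A B) : ℝ≥0∞ :=
  ∑' k, ∑ a, ∑ c, ∑ p, ∑ q, ‖(I k (Matrix.single a c 1) - I' k (Matrix.single a c 1)) p q‖ₑ

/-- LOCC instruments (with possibly infinitely many rounds): `I` is the limit of instruments
`I' ν`, each obtained by stopping after the `ν`-th instrument `P ν` of one sequence of finite-round
protocols in which every protocol continues the preceding one.  On stopping, the two parties bring
their local memories into the output systems by local channels (depending on the outcome, which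
both of them know), and outcomes are coarse-grained. -/
def loccInstruments (A B A' B' : Type*) [Fintype A] [DecidableEq A] [Fintype B] [DecidableEq B]
    [Fintype A'] [Fintype B'] : Set (QInstrument (A × B) (A' × B')) :=
  {I | ∃ (a b : ℕ → ℕ) (Θ : ℕ → Type)
      (P : ∀ ν, Θ ν → SuperOp (A × B) (Fin (a ν) × Fin (b ν)))
      (I' : ℕ → I.Θ → SuperOp (A × B) (A' × B')),
    (∀ ν, IsFiniteLOCC (P ν)) ∧
    (∀ ν, IsLOCCLinked (P ν) (P (ν + 1))) ∧
    (∀ ν, ∃ (S : Θ ν → SuperOp (Fin (a ν)) A') (T : Θ ν → SuperOp (Fin (b ν)) B'),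
      (∀ θ, IsChannel (S θ)) ∧ (∀ θ, IsChannel (T θ)) ∧
      IsCoarseGraining (fun θ => (tensorMap (S θ) (T θ)).comp (P ν θ)) (I' ν)) ∧
    Tendsto (fun ν => instrumentDist (I' ν) I.map) atTop (𝓝 0)}

/-- `LOCC⋆(A;B → A';B')`. -/
def LOCCStar (A B A' B' : Type*) [Fintype A] [DecidableEq A] [Fintype B] [DecidableEq B]
    [Fintype A'] [Fintype B'] : Set (SuperOp (A × B) (A' × B')) :=
  decompositionSet (loccInstruments A B A' B')

/-- The normalized Hilbert-Schmidt inner product `tr[X†Y] / dim A`. -/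
noncomputable def hsInner {A : Type*} [Fintype A] (X Y : Matrix A A ℂ) : ℂ :=
  (X.conjTranspose * Y).trace / (Fintype.card A : ℂ)

/-- `X = ∑ⱼ uⱼ Lⱼ ⊗ Rⱼ` is an operator Schmidt decomposition: `uⱼ > 0`, and `(Lⱼ)ⱼ`, `(Rⱼ)ⱼ` are
orthonormal for the normalized Hilbert-Schmidt inner product. -/
structure IsOperatorSchmidt {A B J : Type*} [Fintype A] [Fintype B] [Fintype J] [DecidableEq J]
    (X : Matrix (A × B) (A × B) ℂ) (u : J → ℝ) (L : J → Matrix A A ℂ)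
    (R : J → Matrix B B ℂ) : Prop where
  pos : ∀ j, 0 < u j
  orthonormal_left : ∀ j k, hsInner (L j) (L k) = if j = k then 1 else 0
  orthonormal_right : ∀ j k, hsInner (R j) (R k) = if j = k then 1 else 0
  eq_sum : X = ∑ j, (u j : ℂ) • (L j ⊗ₖ R j)

/-! ### Superoperators, tensor products and Kraus decompositions -/

section TensorMaps

variable {A B C D A' B' C' D' : Type*} [Fintype A] [DecidableEq A] [Fintype B] [DecidableEq B]

/-! The lower bound is a duality argument. Put d = dim A · dim B and Ω = ∑ Lⱼ ⊗ Rⱼ, and let w(E) =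
(2/d²)⟨Ω|J(E)|Ω⟩ − (1/d) tr E(1), with J(E) the Choi matrix (`extentWitness`). For a Kraus operator
M ⊗ N, Cauchy-Schwarz over j and Bessel's inequality on each side give |tr Ω†(M ⊗ N)|² ≤ d · tr (M ⊗
N)†(M ⊗ N), hence |w(E)| ≤ tr E(1)/d. This persists on the closed convex cone generated by such
maps, which contains every member of an LOCC instrument (`isSepMap_of_mem_loccInstruments`). Summing
over an instrument with weights in [-1, 1] gives |w| ≤ 1 on LOCC⋆, while tr Ω†U = d ∑ uⱼ gives w(𝒰)
= 2(∑ uⱼ)² − 1.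

The upper bound is an explicit decomposition over LO⋆. Expanding UXU† yields terms uⱼuₖ (Lⱼ ⊗ Rⱼ) X
(Lₖ ⊗ Rₖ)†. With H(V,W) : X ↦ (VXW† + WXV†)/2, the symmetrized (j,k) term is H(Lⱼ,Lₖ) ⊗ H(Rⱼ,Rₖ) −
H(Lⱼ,iLₖ) ⊗ H(Rⱼ,iRₖ). For unitary V, W the map H(V,W) is the difference of the two members of the
instrument with Kraus operators (V ± W)/2, so both products lie in LO⋆. Since H(V,iV) = 0, a
diagonal term costs uⱼ² instead of 2uⱼ², and ∑ uⱼ² = 1 makes the total 2(∑ uⱼ)² − 1. The inclusion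
LO⋆ ⊆ LOCC⋆ joins the two bounds.

For two qubits, let C be the coefficient matrix of U in the quaternion basis 1, iX, iY, iZ.
Unitarity of U forces CC† and C†C to be real, so C has a singular value decomposition with real
singular vectors up to phases (`Matrix.exists_real_singular_vectors`). Real unit combinations of the
quaternion basis are unitary, so this is the desired Schmidt decomposition. -/

theorem SuperOp.ext_single {Φ Ψ : SuperOp A C}
    (h : ∀ a b, Φ (Matrix.single a b 1) = Ψ (Matrix.single a b 1)) : Φ = Ψ := by
  ext1 X
  conv_lhs => rw [Matrix.matrix_eq_sum_single X]
  conv_rhs => rw [Matrix.matrix_eq_sum_single X]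
  simp only [map_sum]
  refine Finset.sum_congr rfl fun a _ => Finset.sum_congr rfl fun b _ => ?_
  rw [show Matrix.single a b (X a b) = X a b • Matrix.single a b 1 by simp, map_smul, map_smul, h]

theorem SuperOp.ext_kronecker {Φ Ψ : SuperOp (A × B) C}
    (h : ∀ X Y, Φ (X ⊗ₖ Y) = Ψ (X ⊗ₖ Y)) : Φ = Ψ := by
  refine SuperOp.ext_single fun a b => ?_
  obtain ⟨a₁, a₂⟩ := a
  obtain ⟨b₁, b₂⟩ := b
  have := h (Matrix.single a₁ b₁ 1) (Matrix.single a₂ b₂ 1)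
  rwa [Matrix.single_kronecker_single, one_mul] at this

/-- The superoperator `X ↦ V X W†`. -/
def sandwich (V W : Matrix C A ℂ) : SuperOp A C where
  toFun X := V * X * W.conjTranspose
  map_add' X Y := by rw [Matrix.mul_add, Matrix.add_mul]
  map_smul' c X := by simp

omit [DecidableEq A] in
theorem sandwich_apply (V W : Matrix C A ℂ) (X : Matrix A A ℂ) :
    sandwich V W X = V * X * W.conjTranspose := rfl

omit [DecidableEq A] in
theorem inducedMap_apply (V : Matrix C A ℂ) (X : Matrix A A ℂ) :
    inducedMap V X = V * X * V.conjTranspose := rfl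

theorem tensorMap_sandwich (V W : Matrix C A ℂ) (V' W' : Matrix D B ℂ) :
    tensorMap (sandwich V W) (sandwich V' W') = sandwich (V ⊗ₖ V') (W ⊗ₖ W') := by
  refine SuperOp.ext_kronecker fun X Y => ?_
  rw [tensorMap_kronecker]
  simp only [sandwich_apply, Matrix.conjTranspose_kronecker, Matrix.mul_kronecker_mul]

theorem tensorMap_inducedMap (V : Matrix C A ℂ) (W : Matrix D B ℂ) :
    tensorMap (inducedMap V) (inducedMap W) = inducedMap (V ⊗ₖ W) :=
  tensorMap_sandwich V V W W

theorem tensorMap_comp [Fintype C] [DecidableEq C] [Fintype D] [DecidableEq D]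
    (G : SuperOp C A') (H : SuperOp D B') (E : SuperOp A C) (F : SuperOp B D) :
    (tensorMap G H).comp (tensorMap E F) = tensorMap (G.comp E) (H.comp F) := by
  refine SuperOp.ext_kronecker fun X Y => ?_
  simp only [LinearMap.comp_apply, tensorMap_kronecker]

theorem tensorMap_id :
    tensorMap (LinearMap.id : SuperOp A A) (LinearMap.id : SuperOp B B) = LinearMap.id := by
  refine SuperOp.ext_kronecker fun X Y => ?_
  simp only [LinearMap.id_apply, tensorMap_kronecker]

/-- The tensor product of superoperators as a bilinear map. -/
noncomputable def tensorMapBilin (A B C D : Type*) [Fintype A] [DecidableEq A] [Fintype B]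
    [DecidableEq B] : SuperOp A C →ₗ[ℂ] SuperOp B D →ₗ[ℂ] SuperOp (A × B) (C × D) :=
  LinearMap.mk₂ ℂ tensorMap
    (fun E E' F => SuperOp.ext_kronecker fun X Y => by
      simp only [LinearMap.add_apply, tensorMap_kronecker, Matrix.add_kronecker])
    (fun c E F => SuperOp.ext_kronecker fun X Y => by
      simp only [LinearMap.smul_apply, tensorMap_kronecker, Matrix.smul_kronecker])
    (fun E F F' => SuperOp.ext_kronecker fun X Y => by
      simp only [LinearMap.add_apply, tensorMap_kronecker, Matrix.kronecker_add])
    (fun c E F => SuperOp.ext_kronecker fun X Y => by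
      simp only [LinearMap.smul_apply, tensorMap_kronecker, Matrix.kronecker_smul])

theorem tensorMapBilin_apply (E : SuperOp A C) (F : SuperOp B D) :
    tensorMapBilin A B C D E F = tensorMap E F := rfl

omit [DecidableEq A] in
theorem inducedMap_comp [Fintype C] (V : Matrix D C ℂ) (W : Matrix C A ℂ) :
    (inducedMap V).comp (inducedMap W) = inducedMap (V * W) := by
  ext1 X
  simp only [LinearMap.comp_apply, inducedMap_apply, Matrix.conjTranspose_mul, Matrix.mul_assoc]

theorem inducedMap_one : inducedMap (1 : Matrix A A ℂ) = LinearMap.id := by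
  ext1 X
  simp [inducedMap_apply]

theorem isCP_inducedMap [Fintype C] (V : Matrix C A ℂ) : IsCP (inducedMap V) := by
  intro k ρ hρ
  rw [← inducedMap_one, tensorMap_inducedMap, inducedMap_apply]
  exact hρ.mul_mul_conjTranspose_same _

theorem inducedMap_single_apply (V : Matrix C A ℂ) (a c : A) (p q : C) :
    inducedMap V (Matrix.single a c 1) p q = V p a * star (V q c) := by
  rw [inducedMap_apply, Matrix.mul_apply, Finset.sum_eq_single c]
  · simp
  · intro b _ hb
    rw [Matrix.mul_single_apply_of_ne _ _ _ _ _ hb, zero_mul]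
  · simp

open scoped MatrixOrder in
/-- Choi's theorem: a completely positive map has a Kraus decomposition. -/
theorem IsCP.exists_kraus [Fintype C] [DecidableEq C] {Φ : SuperOp A C} (h : IsCP Φ) :
    ∃ (n : ℕ) (K : Fin n → Matrix C A ℂ), Φ = ∑ i, inducedMap (K i) := by
  classical
  let e := Fintype.equivFin A
  -- The unnormalized maximally entangled vector: applying Φ ⊗ id to its projector gives the Choi
  -- matrix of Φ, whose entries are those of Φ on matrix units (`key`).
  let v : A × Fin (Fintype.card A) → ℂ := fun x => if e x.1 = x.2 then 1 else 0
  have hv : Matrix.vecMulVec v (star v) =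
      ∑ a, ∑ c, Matrix.single a c (1 : ℂ) ⊗ₖ Matrix.single (e a) (e c) (1 : ℂ) := by
    ext ⟨a, x⟩ ⟨c, y⟩
    simp only [Matrix.vecMulVec_apply, Pi.star_apply, v, Matrix.sum_apply,
      Matrix.kroneckerMap_apply, Matrix.single_apply]
    rw [Finset.sum_eq_single a, Finset.sum_eq_single c] <;> simp +contextual [ite_and]
    split_ifs <;> rfl
  have hP := h _ _ (Matrix.posSemidef_vecMulVec_self_star v)
  obtain ⟨M, hM⟩ := CStarAlgebra.nonneg_iff_eq_star_mul_self.mp hP.nonneg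
  have key : ∀ a c p q, Φ (Matrix.single a c 1) p q =
      tensorMap Φ (LinearMap.id : SuperOp (Fin (Fintype.card A)) (Fin (Fintype.card A)))
        (Matrix.vecMulVec v (star v)) (p, e a) (q, e c) := by
    intro a c p q
    rw [hv]
    simp only [map_sum, tensorMap_kronecker, Matrix.sum_apply, Matrix.kroneckerMap_apply,
      LinearMap.id_apply, Matrix.single_apply, e.injective.eq_iff]
    rw [Finset.sum_eq_single a, Finset.sum_eq_single c] <;> simp +contextual
  let f := Fintype.equivFin (C × Fin (Fintype.card A))
  -- The Choi matrix is M†M; each row of M, conjugated and reshaped, is a Kraus operator.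
  refine ⟨_, fun i => Matrix.of fun p a => star (M (f.symm i) (p, e a)), ?_⟩
  refine SuperOp.ext_single fun a c => ?_
  ext p q
  rw [key, hM, Matrix.star_eq_conjTranspose, LinearMap.sum_apply, Matrix.sum_apply]
  simp only [inducedMap_single_apply, Matrix.mul_apply, Matrix.conjTranspose_apply, Matrix.of_apply,
    star_star]
  exact (f.symm.sum_comp fun i => star (M i (p, e a)) * M i (q, e c)).symm

end TensorMaps

/-! ### Separable maps and the separability of LOCC -/

section Separable

variable {A B C D : Type*} [Fintype A] [DecidableEq A] [Fintype B] [DecidableEq B]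

/-- Real-linear functionals on superoperators are sums of functionals of the Choi matrix entries. -/
theorem SuperOp.exists_functional_eq_sum [Fintype C] (w : SuperOp A C →ₗ[ℝ] ℝ) :
    ∃ g : A → A → C → C → ℂ →L[ℝ] ℝ,
      ∀ E : SuperOp A C, w E = ∑ a, ∑ c, ∑ p, ∑ q, g a c p q (E (Matrix.single a c 1) p q) := by
  classical
  -- The matrix units of the space of superoperators; the coordinates of E in them are its Choi
  -- entries.
  let b : A → A → C → C → SuperOp A C := fun a c p q =>
    LinearMap.toSpanSingleton ℂ _ (Matrix.single p q (1 : ℂ)) ∘ₗ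
      Matrix.entryLinearMap ℂ ℂ a c
  have hb : ∀ a c p q X, b a c p q X = X a c • Matrix.single p q (1 : ℂ) := fun _ _ _ _ _ => rfl
  refine ⟨fun a c p q => LinearMap.toContinuousLinearMap
    (w ∘ₗ (LinearMap.toSpanSingleton ℂ (SuperOp A C) (b a c p q)).restrictScalars ℝ),
    fun E => ?_⟩
  have hE : E = ∑ a, ∑ c, ∑ p, ∑ q, E (Matrix.single a c 1) p q • b a c p q := by
    refine SuperOp.ext_single fun a c => ?_
    simp only [LinearMap.sum_apply, LinearMap.smul_apply, hb]
    rw [Finset.sum_eq_single a, Finset.sum_eq_single c]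
    · conv_lhs => rw [Matrix.matrix_eq_sum_single (E (Matrix.single a c 1))]
      simp
    · intro c' _ hc
      simp [hc.symm]
    · simp
    · intro a' _ ha
      simp [ha.symm]
    · simp
  conv_lhs => rw [hE]
  simp only [map_sum]
  rfl

/-- A functional depends on finitely many Choi entries, so pointwise convergence suffices and no
topology on the space of superoperators is needed. -/
theorem SuperOp.hasSum_functional [Fintype C] {ι : Type*} {E : ι → SuperOp A C} {Φ : SuperOp A C}
    (h : ∀ ω, HasSum (fun i => E i ω) (Φ ω)) (w : SuperOp A C →ₗ[ℝ] ℝ) :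
    HasSum (fun i => w (E i)) (w Φ) := by
  obtain ⟨g, hg⟩ := SuperOp.exists_functional_eq_sum w
  simp only [hg]
  refine hasSum_sum fun a _ => hasSum_sum fun c _ => hasSum_sum fun p _ => hasSum_sum fun q _ => ?_
  have hpq : HasSum (fun i => E i (Matrix.single a c 1) p q) (Φ (Matrix.single a c 1) p q) :=
    (h (Matrix.single a c 1)).map (Matrix.entryAddMonoidHom ℂ p q)
      (continuous_id.matrix_elem p q)
  exact (g a c p q).hasSum hpq

theorem SuperOp.tendsto_functional [Fintype C] {ι : Type*} {l : Filter ι} {E : ι → SuperOp A C}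
    {Φ : SuperOp A C}
    (h : ∀ a c p q, Tendsto (fun i => E i (Matrix.single a c 1) p q) l
      (𝓝 (Φ (Matrix.single a c 1) p q))) (w : SuperOp A C →ₗ[ℝ] ℝ) :
    Tendsto (fun i => w (E i)) l (𝓝 (w Φ)) := by
  obtain ⟨g, hg⟩ := SuperOp.exists_functional_eq_sum w
  simp only [hg]
  exact tendsto_finsetSum _ fun a _ => tendsto_finsetSum _ fun c _ => tendsto_finsetSum _ fun p _ =>
    tendsto_finsetSum _ fun q _ => ((g a c p q).continuous.tendsto _).comp (h a c p q)

/-- Membership in the closed convex cone generated by the maps `X ↦ (M ⊗ N) X (M ⊗ N)†`,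
expressed through the dual cone. -/
def IsSepMap (E : SuperOp (A × B) (C × D)) : Prop :=
  ∀ w : SuperOp (A × B) (C × D) →ₗ[ℝ] ℝ,
    (∀ (M : Matrix C A ℂ) (N : Matrix D B ℂ), 0 ≤ w (inducedMap (M ⊗ₖ N))) → 0 ≤ w E

omit [DecidableEq A] [DecidableEq B] in
theorem isSepMap_inducedMap (M : Matrix C A ℂ) (N : Matrix D B ℂ) :
    IsSepMap (inducedMap (M ⊗ₖ N)) := fun _ hw => hw M N

omit [DecidableEq A] [DecidableEq B] in
theorem IsSepMap.sum {ι : Type*} {s : Finset ι} {E : ι → SuperOp (A × B) (C × D)}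
    (h : ∀ i ∈ s, IsSepMap (E i)) : IsSepMap (∑ i ∈ s, E i) := fun w hw => by
  rw [map_sum]
  exact Finset.sum_nonneg fun i hi => h i hi w hw

theorem IsSepMap.of_hasSum [Fintype C] [Fintype D] {ι : Type*} {E : ι → SuperOp (A × B) (C × D)}
    {Φ : SuperOp (A × B) (C × D)} (hE : ∀ i, IsSepMap (E i))
    (h : ∀ ω, HasSum (fun i => E i ω) (Φ ω)) : IsSepMap Φ := fun w hw =>
  (SuperOp.hasSum_functional h w).nonneg fun i => hE i w hw

/-- Multiplying out the Kraus decompositions of the two factors leaves only product Kraus operators.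
-/
theorem isSepMap_tensorMap [Fintype C] [DecidableEq C] [Fintype D] [DecidableEq D]
    {E : SuperOp A C} {F : SuperOp B D} (hE : IsCP E) (hF : IsCP F) :
    IsSepMap (tensorMap E F) := by
  obtain ⟨m, K, rfl⟩ := hE.exists_kraus
  obtain ⟨n, K', rfl⟩ := hF.exists_kraus
  rw [← tensorMapBilin_apply, map_sum]
  refine IsSepMap.sum fun j _ => ?_
  rw [map_sum, LinearMap.sum_apply]
  refine IsSepMap.sum fun i _ => ?_
  rw [tensorMapBilin_apply, tensorMap_inducedMap]
  exact isSepMap_inducedMap _ _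

omit [DecidableEq A] [DecidableEq B] in
-- Products of product Kraus operators are again products. In dual terms, w is pulled back along
-- composition, in one argument at a time, and each pullback is nonnegative on the generators.
theorem IsSepMap.comp [Fintype C] [DecidableEq C] [Fintype D] [DecidableEq D] {A' B' : Type*}
    {G : SuperOp (C × D) (A' × B')} {E : SuperOp (A × B) (C × D)} (hG : IsSepMap G)
    (hE : IsSepMap E) : IsSepMap (G.comp E) := by
  intro w hw
  refine hG (w ∘ₗ (LinearMap.lcomp ℂ _ E).restrictScalars ℝ) fun M N => ?_
  refine hE (w ∘ₗ (LinearMap.llcomp ℂ _ _ _ (inducedMap (M ⊗ₖ N))).restrictScalars ℝ)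
    fun M' N' => ?_
  change 0 ≤ w ((inducedMap _).comp (inducedMap _))
  rw [inducedMap_comp, ← Matrix.mul_kronecker_mul]
  exact hw _ _

variable [Fintype C] [DecidableEq C] [Fintype D] [DecidableEq D]

omit [DecidableEq C] [DecidableEq D] in
theorem IsCoarseGraining.isSepMap {ι κ : Type*} {I : ι → SuperOp (A × B) (C × D)}
    {I' : κ → SuperOp (A × B) (C × D)} (h : IsCoarseGraining I I') (hI : ∀ i, IsSepMap (I i))
    (k : κ) : IsSepMap (I' k) := by
  obtain ⟨f, hf⟩ := h
  exact IsSepMap.of_hasSum (E := fun i : {i // f i = k} => I i) (fun i => hI i.1) (hf k)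

theorem IsOneWayLocal.isSepMap {ι : Type} {I : ι → SuperOp (A × B) (C × D)}
    (h : IsOneWayLocal I) (i : ι) : IsSepMap (I i) := by
  obtain ⟨E, e, T, hT, hI⟩ | ⟨F, e, T, hT, hI⟩ := h
  · rw [hI]
    exact isSepMap_tensorMap (E.isCP _) (hT i).1
  · rw [hI]
    exact isSepMap_tensorMap (hT i).1 (F.isCP _)

theorem IsLOCCLinked.isSepMap {A' B' : Type*} [Fintype A'] [DecidableEq A'] [Fintype B']
    [DecidableEq B'] {ι κ : Type} {I : ι → SuperOp (A × B) (C × D)}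
    {I' : κ → SuperOp (A × B) (A' × B')} (h : IsLOCCLinked I I') (hI : ∀ i, IsSepMap (I i))
    (k : κ) : IsSepMap (I' k) := by
  obtain ⟨μ, K, hK, hc⟩ := h
  exact hc.isSepMap (fun p => ((hK p.1).isSepMap p.2).comp (hI p.1)) k

theorem IsFiniteLOCC.isSepMap {a b : ℕ} {ι : Type} {I : ι → SuperOp (A × B) (Fin a × Fin b)}
    (h : IsFiniteLOCC I) : ∀ i, IsSepMap (I i) := by
  induction h with
  | one I I' _ hI hc => exact hc.isSepMap hI.isSepMap
  | link I I' _ _ hl ih => exact hl.isSepMap ih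

omit [DecidableEq C] in
-- The distance of each Choi entry is a single summand of `instrumentDist`.
theorem tendsto_apply_of_instrumentDist {κ : Type*} {I' : ℕ → κ → SuperOp A C}
    {I : κ → SuperOp A C} (h : Tendsto (fun ν => instrumentDist (I' ν) I) atTop (𝓝 0))
    (k : κ) (a c : A) (p q : C) :
    Tendsto (fun ν => I' ν k (Matrix.single a c 1) p q) atTop
      (𝓝 (I k (Matrix.single a c 1) p q)) := by
  rw [tendsto_iff_edist_tendsto_0]
  refine tendsto_of_tendsto_of_tendsto_of_le_of_le tendsto_const_nhds h (fun _ => zero_le)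
    fun ν => ?_
  rw [edist_eq_enorm_sub, ← Matrix.sub_apply]
  refine le_trans ?_ (ENNReal.le_tsum k)
  let f : A → A → C → C → ℝ≥0∞ := fun a c p q =>
    ‖(I' ν k (Matrix.single a c 1) - I k (Matrix.single a c 1)) p q‖ₑ
  calc f a c p q ≤ ∑ q, f a c p q :=
        Finset.single_le_sum (f := fun q => f a c p q) (fun _ _ => zero_le) (Finset.mem_univ q)
    _ ≤ ∑ p, ∑ q, f a c p q := Finset.single_le_sum (f := fun p => ∑ q, f a c p q)
        (fun _ _ => zero_le) (Finset.mem_univ p)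
    _ ≤ ∑ c, ∑ p, ∑ q, f a c p q := Finset.single_le_sum (f := fun c => ∑ p, ∑ q, f a c p q)
        (fun _ _ => zero_le) (Finset.mem_univ c)
    _ ≤ ∑ a, ∑ c, ∑ p, ∑ q, f a c p q :=
        Finset.single_le_sum (f := fun a => ∑ c, ∑ p, ∑ q, f a c p q)
          (fun _ _ => zero_le) (Finset.mem_univ a)

/-- The members of LOCC instruments are separable maps. -/
theorem isSepMap_of_mem_loccInstruments {I : QInstrument (A × B) (C × D)}
    (h : I ∈ loccInstruments A B C D) (k : I.Θ) : IsSepMap (I.map k) := by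
  obtain ⟨a, b, Θ, P, I', hP, -, hI', hlim⟩ := h
  have hsep : ∀ ν, IsSepMap (I' ν k) := by
    intro ν
    obtain ⟨S, T, hS, hT, hc⟩ := hI' ν
    exact hc.isSepMap
      (fun θ => (isSepMap_tensorMap (hS θ).1 (hT θ).1).comp ((hP ν).isSepMap θ)) k
  intro w hw
  exact ge_of_tendsto' (SuperOp.tendsto_functional (tendsto_apply_of_instrumentDist hlim k) w)
    fun ν => hsep ν w hw

end Separable

/-! ### The witness and the lower bound -/

section Witness

variable {A B J : Type*} [Fintype A] [DecidableEq A] [Fintype B] [DecidableEq B] [Fintype J]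

/-- The quadratic form `⟨Ω|J(E)|Ω⟩` of the Choi matrix `J(E)`, as a functional of `E`. -/
noncomputable def choiForm (Ω : Matrix A A ℂ) : SuperOp A A →ₗ[ℝ] ℝ where
  toFun E := (∑ p, ∑ q, ∑ r, ∑ s, star (Ω p q) * Ω r s * E (Matrix.single q s 1) p r).re
  map_add' E F := by simp [mul_add, Finset.sum_add_distrib]
  map_smul' c E := by
    simp only [LinearMap.smul_apply, Matrix.smul_apply, RingHom.id_apply, Complex.real_smul,
      smul_eq_mul]
    rw [← Complex.re_ofReal_mul]
    simp only [Finset.mul_sum]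
    refine congrArg Complex.re (Finset.sum_congr rfl fun p _ => Finset.sum_congr rfl fun q _ =>
      Finset.sum_congr rfl fun r _ => Finset.sum_congr rfl fun s _ => ?_)
    ring

/-- The trace `tr[E(1)]`, as a functional of `E`. -/
noncomputable def traceForm (A : Type*) [Fintype A] [DecidableEq A] : SuperOp A A →ₗ[ℝ] ℝ where
  toFun E := (E 1).trace.re
  map_add' E F := by simp
  map_smul' c E := by simp

theorem traceForm_apply (E : SuperOp A A) : traceForm A E = (E 1).trace.re := rfl

theorem choiForm_inducedMap (Ω K : Matrix A A ℂ) :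
    choiForm Ω (inducedMap K) = ‖(Ω.conjTranspose * K).trace‖ ^ 2 := by
  have h : (Ω.conjTranspose * K).trace = ∑ p, ∑ q, star (Ω p q) * K p q := by
    simp only [Matrix.trace, Matrix.diag, Matrix.mul_apply, Matrix.conjTranspose_apply]
    exact Finset.sum_comm
  rw [← Complex.normSq_eq_norm_sq, ← Complex.ofReal_re (Complex.normSq _),
    ← Complex.mul_conj, mul_comm, h]
  change (Complex.re _ : ℝ) = _
  congr 1
  simp only [inducedMap_single_apply, map_sum, Finset.sum_mul, Finset.mul_sum, map_mul]
  refine Finset.sum_congr rfl fun p _ => Finset.sum_congr rfl fun q _ =>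
    Finset.sum_congr rfl fun r _ => Finset.sum_congr rfl fun s _ => ?_
  simp
  ring

theorem traceForm_inducedMap (K : Matrix A A ℂ) :
    traceForm A (inducedMap K) = (K.conjTranspose * K).trace.re := by
  rw [traceForm_apply, inducedMap_apply, mul_one, Matrix.trace_mul_comm]

omit [DecidableEq A] [Fintype J] in
theorem trace_eq_of_hsInner [Nonempty A] [DecidableEq J] {L : J → Matrix A A ℂ}
    (hL : ∀ j k, hsInner (L j) (L k) = if j = k then 1 else 0) (j k : J) :
    ((L j).conjTranspose * L k).trace = if j = k then (Fintype.card A : ℂ) else 0 := by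
  have hA : (Fintype.card A : ℂ) ≠ 0 := by exact_mod_cast Fintype.card_ne_zero
  have h := hL j k
  rw [hsInner, div_eq_iff hA] at h
  simp [h]

omit [DecidableEq A] in
/-- Bessel's inequality for the normalized Hilbert-Schmidt inner product. -/
theorem sum_norm_trace_sq_le [Nonempty A] [DecidableEq J] {L : J → Matrix A A ℂ}
    (hL : ∀ j k, hsInner (L j) (L k) = if j = k then 1 else 0) (M : Matrix A A ℂ) :
    ∑ j, ‖((L j).conjTranspose * M).trace‖ ^ 2 ≤
      Fintype.card A * (M.conjTranspose * M).trace.re := by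
  have hd : (0 : ℝ) < Fintype.card A := by exact_mod_cast Fintype.card_pos
  let v : Matrix A A ℂ → EuclideanSpace ℂ (A × A) := fun X => WithLp.toLp 2 fun x => X x.1 x.2
  have hv : ∀ X Y, inner ℂ (v X) (v Y) = (X.conjTranspose * Y).trace := by
    intro X Y
    simp only [v, PiLp.inner_apply, RCLike.inner_apply, Fintype.sum_prod_type, Matrix.trace,
      Matrix.diag, Matrix.mul_apply, Matrix.conjTranspose_apply]
    rw [Finset.sum_comm]
    exact Finset.sum_congr rfl fun p _ => Finset.sum_congr rfl fun q _ => mul_comm _ _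
  -- Scaling by 1/√(dim A) turns normalized Hilbert-Schmidt orthonormality into orthonormality in
  -- the Euclidean space of matrix entries.
  let s : ℝ := (Real.sqrt (Fintype.card A))⁻¹
  have hs : s ^ 2 = (Fintype.card A : ℝ)⁻¹ := by
    simp only [s, inv_pow, Real.sq_sqrt hd.le]
  have hon : Orthonormal ℂ fun j => (s : ℂ) • v (L j) := by
    rw [orthonormal_iff_ite]
    intro i j
    rw [inner_smul_left, inner_smul_right, hv, ← hL, hsInner, Complex.conj_ofReal, ← mul_assoc,
      ← sq, ← Complex.ofReal_pow, hs]
    push_cast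
    rw [div_eq_inv_mul]
  have hb := hon.sum_inner_products_le (v M) (s := Finset.univ)
  have hn : ‖v M‖ ^ 2 = (M.conjTranspose * M).trace.re := by
    rw [← hv, inner_self_eq_norm_sq_to_K]
    norm_cast
  rw [hn] at hb
  have hterm : ∀ j, ‖inner ℂ ((s : ℂ) • v (L j)) (v M)‖ ^ 2 =
      (Fintype.card A : ℝ)⁻¹ * ‖((L j).conjTranspose * M).trace‖ ^ 2 := by
    intro j
    rw [inner_smul_left, hv, norm_mul, mul_pow, Complex.conj_ofReal, Complex.norm_real,
      Real.norm_eq_abs, sq_abs, hs]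
  simp only [hterm, ← Finset.mul_sum] at hb
  rwa [inv_mul_le_iff₀ hd] at hb

variable [Nonempty A] [Nonempty B] [DecidableEq J]

omit [DecidableEq A] [DecidableEq B] in
-- The trace factorizes termwise into ∑ⱼ tr(Lⱼ†M) tr(Rⱼ†N); Cauchy-Schwarz separates the parties and
-- Bessel bounds each. For a general operator in place of M ⊗ N this fails, which is what detects
-- entanglement.
theorem norm_trace_sum_kronecker_sq_le {L : J → Matrix A A ℂ} {R : J → Matrix B B ℂ}
    (hL : ∀ j k, hsInner (L j) (L k) = if j = k then 1 else 0)
    (hR : ∀ j k, hsInner (R j) (R k) = if j = k then 1 else 0)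
    (M : Matrix A A ℂ) (N : Matrix B B ℂ) :
    ‖((∑ j, L j ⊗ₖ R j).conjTranspose * (M ⊗ₖ N)).trace‖ ^ 2 ≤
      (Fintype.card A * Fintype.card B) *
        ((M ⊗ₖ N).conjTranspose * (M ⊗ₖ N)).trace.re := by
  have h1 : ((∑ j, L j ⊗ₖ R j).conjTranspose * (M ⊗ₖ N)).trace =
      ∑ j, ((L j).conjTranspose * M).trace * ((R j).conjTranspose * N).trace := by
    simp only [Matrix.conjTranspose_sum, Matrix.sum_mul, Matrix.trace_sum,
      Matrix.conjTranspose_kronecker, ← Matrix.mul_kronecker_mul, Matrix.trace_kronecker]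
  have h2 : ((M ⊗ₖ N).conjTranspose * (M ⊗ₖ N)).trace.re =
      (M.conjTranspose * M).trace.re * (N.conjTranspose * N).trace.re := by
    -- The trace of M†M is real, so the real part of the product of traces is the product of real
    -- parts.
    rw [Matrix.conjTranspose_kronecker, ← Matrix.mul_kronecker_mul, Matrix.trace_kronecker,
      Complex.mul_re,
      ← (Complex.nonneg_iff.mp (Matrix.posSemidef_conjTranspose_mul_self M).trace_nonneg).2]
    simp
  rw [h1, h2]
  calc _ ≤ (∑ j, ‖((L j).conjTranspose * M).trace‖ * ‖((R j).conjTranspose * N).trace‖) ^ 2 := by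
        gcongr
        refine (norm_sum_le _ _).trans_eq (Finset.sum_congr rfl fun j _ => norm_mul _ _)
    _ ≤ (∑ j, ‖((L j).conjTranspose * M).trace‖ ^ 2) *
          ∑ j, ‖((R j).conjTranspose * N).trace‖ ^ 2 := Finset.sum_mul_sq_le_sq_mul_sq _ _ _
    _ ≤ (Fintype.card A * (M.conjTranspose * M).trace.re) *
          (Fintype.card B * (N.conjTranspose * N).trace.re) := by
        have hM := sum_norm_trace_sq_le hL M
        exact mul_le_mul hM (sum_norm_trace_sq_le hR N) (by positivity)
          ((Finset.sum_nonneg fun _ _ => by positivity).trans hM)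
    _ = _ := by ring

/-- The entanglement witness attached to the families `L` and `R`. -/
noncomputable def extentWitness (L : J → Matrix A A ℂ) (R : J → Matrix B B ℂ) :
    SuperOp (A × B) (A × B) →ₗ[ℝ] ℝ :=
  (2 / (Fintype.card A * Fintype.card B : ℝ) ^ 2) • choiForm (∑ j, L j ⊗ₖ R j) -
    (1 / (Fintype.card A * Fintype.card B : ℝ)) • traceForm (A × B)

/-- With o the Choi form and t = tr E(1), separability gives 0 ≤ o ≤ d·t, that is |2o − d·t| ≤ d·t.
The two inequalities are tested on product Kraus operators, as the dual description of the cone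
permits. -/
theorem IsSepMap.abs_extentWitness_le {L : J → Matrix A A ℂ} {R : J → Matrix B B ℂ}
    (hL : ∀ j k, hsInner (L j) (L k) = if j = k then 1 else 0)
    (hR : ∀ j k, hsInner (R j) (R k) = if j = k then 1 else 0)
    {E : SuperOp (A × B) (A × B)} (hE : IsSepMap E) :
    |extentWitness L R E| ≤ (E 1).trace.re / (Fintype.card A * Fintype.card B) := by
  have hd : (0 : ℝ) < Fintype.card A * Fintype.card B := by
    have hA : 0 < Fintype.card A := Fintype.card_pos
    have hB : 0 < Fintype.card B := Fintype.card_pos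
    positivity
  have h0 : 0 ≤ choiForm (∑ j, L j ⊗ₖ R j) E := hE _ fun M N => by
    rw [choiForm_inducedMap]
    positivity
  have h1 : 0 ≤ ((Fintype.card A * Fintype.card B : ℝ) • traceForm (A × B) -
      choiForm (∑ j, L j ⊗ₖ R j)) E := hE _ fun M N => by
    rw [LinearMap.sub_apply, LinearMap.smul_apply, choiForm_inducedMap, traceForm_inducedMap,
      sub_nonneg]
    exact norm_trace_sum_kronecker_sq_le hL hR M N
  rw [LinearMap.sub_apply, LinearMap.smul_apply, smul_eq_mul, sub_nonneg] at h1
  rw [extentWitness, LinearMap.sub_apply, LinearMap.smul_apply, LinearMap.smul_apply,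
    ← traceForm_apply]
  simp only [smul_eq_mul]
  set d : ℝ := Fintype.card A * Fintype.card B
  set o := choiForm (∑ j, L j ⊗ₖ R j) E
  set t := traceForm (A × B) E
  have e1 : 2 / d ^ 2 * o - 1 / d * t = (2 * o - d * t) / d ^ 2 := by field_simp
  have e2 : t / d = d * t / d ^ 2 := by field_simp
  rw [e1, e2, abs_div, abs_of_pos (pow_pos hd 2)]
  gcongr
  rw [abs_le]
  constructor <;> linarith

/-- The bounds tr Eᵢ(1)/d of the instrument members sum to 1 by trace preservation, and weights βᵢ ∈
[-1, 1] do not enlarge them. -/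
theorem abs_extentWitness_le_one {L : J → Matrix A A ℂ} {R : J → Matrix B B ℂ}
    (hL : ∀ j k, hsInner (L j) (L k) = if j = k then 1 else 0)
    (hR : ∀ j k, hsInner (R j) (R k) = if j = k then 1 else 0)
    {F : SuperOp (A × B) (A × B)} (hF : F ∈ LOCCStar A B A B) :
    |extentWitness L R F| ≤ 1 := by
  obtain ⟨I, hI, β, hβ, hsum⟩ := hF
  obtain ⟨Φ, hΦ, hTP⟩ := I.sum_isTP
  have hd : (Fintype.card A * Fintype.card B : ℝ) ≠ 0 := by
    have hA : 0 < Fintype.card A := Fintype.card_pos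
    have hB : 0 < Fintype.card B := Fintype.card_pos
    positivity
  have h1 : HasSum (fun i => (I.map i 1).trace.re / (Fintype.card A * Fintype.card B : ℝ)) 1 := by
    have := (SuperOp.hasSum_functional hΦ (traceForm (A × B))).div_const
      (Fintype.card A * Fintype.card B : ℝ)
    rw [traceForm_apply Φ, hTP, Matrix.trace_one] at this
    simpa [traceForm_apply, hd] using this
  have h2 := SuperOp.hasSum_functional (E := fun i => (β i : ℂ) • I.map i) hsum (extentWitness L R)
  rw [← h2.tsum_eq, ← Real.norm_eq_abs]
  refine tsum_of_norm_bounded h1 fun i => ?_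
  have h3 : (β i : ℂ) • I.map i = β i • I.map i := by
    ext1 X
    rfl
  rw [h3, map_smul, norm_smul, Real.norm_eq_abs, Real.norm_eq_abs]
  refine (mul_le_of_le_one_left (abs_nonneg _) (abs_le.mpr (hβ i))).trans ?_
  exact (isSepMap_of_mem_loccInstruments hI i).abs_extentWitness_le hL hR

/-- Orthogonality of the Lⱼ and Rⱼ leaves tr Ω†U = d ∑ uⱼ, and tr U†U = d contributes the −1. -/
theorem IsOperatorSchmidt.extentWitness_inducedMap {U : Matrix (A × B) (A × B) ℂ} {u : J → ℝ}
    {L : J → Matrix A A ℂ} {R : J → Matrix B B ℂ} (hU : U ∈ Matrix.unitaryGroup (A × B) ℂ)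
    (h : IsOperatorSchmidt U u L R) :
    extentWitness L R (inducedMap U) = 2 * (∑ j, u j) ^ 2 - 1 := by
  have hA' : (Fintype.card A : ℝ) ≠ 0 := by exact_mod_cast Fintype.card_ne_zero
  have hB' : (Fintype.card B : ℝ) ≠ 0 := by exact_mod_cast Fintype.card_ne_zero
  have h1 : ((∑ j, L j ⊗ₖ R j).conjTranspose * U).trace =
      ((∑ j, u j : ℝ) : ℂ) * (Fintype.card A * Fintype.card B) := by
    have hl := trace_eq_of_hsInner h.orthonormal_left
    have hr := trace_eq_of_hsInner h.orthonormal_right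
    conv_lhs => rw [h.eq_sum]
    simp only [Matrix.conjTranspose_sum, Matrix.sum_mul, Matrix.mul_sum, Matrix.trace_sum,
      Matrix.mul_smul, Matrix.trace_smul,
      Matrix.conjTranspose_kronecker, ← Matrix.mul_kronecker_mul, Matrix.trace_kronecker, hl, hr]
    simp [Finset.sum_mul]
  have h2 : (U.conjTranspose * U).trace.re = Fintype.card A * Fintype.card B := by
    rw [← Matrix.star_eq_conjTranspose, (Matrix.mem_unitaryGroup_iff').mp hU, Matrix.trace_one]
    simp
  rw [extentWitness, LinearMap.sub_apply, LinearMap.smul_apply, LinearMap.smul_apply,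
    choiForm_inducedMap, traceForm_inducedMap, h1, h2]
  have h3 : ‖((∑ j, u j : ℝ) : ℂ) * (Fintype.card A * Fintype.card B)‖ ^ 2 =
      (∑ j, u j) ^ 2 * (Fintype.card A * Fintype.card B : ℝ) ^ 2 := by
    rw [norm_mul, Complex.norm_real, norm_mul, Complex.norm_natCast, Complex.norm_natCast,
      mul_pow, Real.norm_eq_abs, sq_abs]
  rw [h3]
  simp only [smul_eq_mul]
  field_simp

theorem IsOperatorSchmidt.le_quasiprobExtent_LOCCStar {U : Matrix (A × B) (A × B) ℂ} {u : J → ℝ}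
    {L : J → Matrix A A ℂ} {R : J → Matrix B B ℂ} (hU : U ∈ Matrix.unitaryGroup (A × B) ℂ)
    (h : IsOperatorSchmidt U u L R) :
    ENNReal.ofReal (2 * (∑ j, u j) ^ 2 - 1) ≤
      quasiprobExtent (LOCCStar A B A B) (inducedMap U) := by
  refine le_sInf ?_
  rintro x ⟨m, -, a, F, hF, hE, rfl⟩
  refine ENNReal.ofReal_le_ofReal ?_
  rw [← h.extentWitness_inducedMap hU, hE, map_sum]
  refine Finset.sum_le_sum fun i _ => ?_
  have h3 : (a i : ℂ) • F i = a i • F i := by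
    ext1 X
    rfl
  rw [h3, map_smul, smul_eq_mul]
  refine (le_abs_self _).trans ?_
  rw [abs_mul]
  exact mul_le_of_le_one_right (abs_nonneg _)
    (abs_extentWitness_le_one h.orthonormal_left h.orthonormal_right (hF i))

end Witness

/-! ### Local operations: inclusion into LOCC and the explicit decomposition -/

section LocalOperations

variable {A B C D : Type*} [Fintype A] [DecidableEq A] [Fintype B] [DecidableEq B]

theorem IsCP.comp [Fintype C] [DecidableEq C] {G : SuperOp C D} {E : SuperOp A C} (hG : IsCP G)
    (hE : IsCP E) : IsCP (G.comp E) := by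
  intro k ρ hρ
  rw [show (LinearMap.id : SuperOp (Fin k) (Fin k)) = LinearMap.id.comp LinearMap.id from rfl,
    ← tensorMap_comp]
  exact hG k _ (hE k ρ hρ)

theorem isChannel_inducedMap [Fintype C] {V : Matrix C A ℂ} (hV : V.conjTranspose * V = 1) :
    IsChannel (inducedMap V) := by
  refine ⟨isCP_inducedMap V, fun ω => ?_⟩
  rw [inducedMap_apply, Matrix.trace_mul_comm, ← Matrix.mul_assoc, hV, Matrix.one_mul]

theorem isChannel_id : IsChannel (LinearMap.id : SuperOp A A) := by
  rw [← inducedMap_one]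
  exact isChannel_inducedMap (by simp)

/-- Finite-round protocols are stated with `Fin`-indexed memories; this relabelling unitary moves
arbitrary index types into that setting and back. -/
theorem exists_unitary_fin (A : Type*) [Fintype A] [DecidableEq A] :
    ∃ V : Matrix (Fin (Fintype.card A)) A ℂ,
      V.conjTranspose * V = 1 ∧ V * V.conjTranspose = 1 := by
  let e := Fintype.equivFin A
  refine ⟨(1 : Matrix A A ℂ).submatrix e.symm id, ?_, ?_⟩
  · rw [Matrix.conjTranspose_submatrix, Matrix.submatrix_mul_equiv]
    simp
  · rw [Matrix.conjTranspose_submatrix, ← Matrix.submatrix_mul _ _ _ _ _ Function.bijective_id]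
    simp

/-- The one-outcome instrument of a channel. -/
def QInstrument.ofChannel [Fintype C] {Φ : SuperOp A C} (h : IsChannel Φ) : QInstrument A C where
  Θ := Unit
  countable := inferInstance
  map _ := Φ
  isCP _ := h.1
  sum_isTP := ⟨Φ, fun _ => hasSum_unique _, h.2⟩

/-- An instrument preceded and followed by isometric channels. -/
def QInstrument.conj [Fintype C] [Fintype D] [DecidableEq D] {A' : Type*} [Fintype A']
    [DecidableEq A'] (E : QInstrument A A')
    {V : Matrix C A' ℂ} {W : Matrix A D ℂ} (hV : V.conjTranspose * V = 1)
    (hW : W.conjTranspose * W = 1) : QInstrument D C where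
  Θ := E.Θ
  countable := E.countable
  map i := (inducedMap V).comp ((E.map i).comp (inducedMap W))
  isCP i := (isCP_inducedMap V).comp ((E.isCP i).comp (isCP_inducedMap W))
  sum_isTP := by
    obtain ⟨Φ, hΦ, hTP⟩ := E.sum_isTP
    refine ⟨(inducedMap V).comp (Φ.comp (inducedMap W)), fun ω => ?_, fun ω => ?_⟩
    · refine (hΦ (inducedMap W ω)).map (inducedMap V) ?_
      exact (continuous_const.matrix_mul continuous_id).matrix_mul continuous_const
    · exact ((isChannel_inducedMap hV).2 _).trans ((hTP _).trans ((isChannel_inducedMap hW).2 _))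

theorem isCoarseGraining_of_equiv {A B ι κ : Type*} {I : ι → SuperOp A B} {I' : κ → SuperOp A B}
    (f : ι ≃ κ) (h : ∀ i, I i = I' (f i)) : IsCoarseGraining I I' := by
  refine ⟨f, fun k ω => ?_⟩
  have hk : f (f.symm k) = k := f.apply_symm_apply k
  have : I' k ω = (fun i : {i // f i = k} => I i ω) ⟨f.symm k, hk⟩ := by
    simp [h]
  rw [this]
  refine hasSum_single _ fun i hi => ?_
  exact absurd (Subtype.ext ((f.eq_symm_apply).mpr i.2)) hi

variable [Fintype C] [DecidableEq C] [Fintype D] [DecidableEq D]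

theorem isOneWayLocal_id : IsOneWayLocal fun _ : Unit => (LinearMap.id : SuperOp (A × B) (A × B)) :=
  Or.inl ⟨QInstrument.ofChannel isChannel_id, Equiv.refl _, fun _ => LinearMap.id,
    fun _ => isChannel_id, fun _ => tensorMap_id.symm⟩

omit [Fintype A] [DecidableEq A] [Fintype B] [DecidableEq B] in
-- A round in which nothing is done; it allows constant sequences of protocols.
theorem isLOCCLinked_self {ι : Type} (I : ι → SuperOp (A × B) (C × D)) : IsLOCCLinked I I :=
  ⟨fun _ => Unit, fun _ _ => LinearMap.id, fun _ => isOneWayLocal_id,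
    isCoarseGraining_of_equiv (Equiv.sigmaPUnit ι) fun _ => rfl⟩

theorem loInstruments_subset_loccInstruments :
    loInstruments A B C D ⊆ loccInstruments A B C D := by
  rintro I ⟨E, F, e, hI⟩
  obtain ⟨VB, hVB, hVB'⟩ := exists_unitary_fin B
  obtain ⟨VC, hVC, hVC'⟩ := exists_unitary_fin C
  obtain ⟨VD, hVD, hVD'⟩ := exists_unitary_fin D
  let P : I.Θ → SuperOp (A × B) (Fin (Fintype.card C) × Fin (Fintype.card D)) := fun i =>
    tensorMap ((inducedMap VC).comp (E.map (e i).1)) ((inducedMap VD).comp (F.map (e i).2))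
  have hP : IsFiniteLOCC P := by
    have h1A : (1 : Matrix A A ℂ).conjTranspose * 1 = 1 := by simp
    -- First round: one party applies its instrument while the other merely relabels its system. In
    -- the second round the other party undoes the relabelling and applies its own instrument,
    -- ignoring the announced outcome.
    let I₁ : E.Θ → SuperOp (A × B) (Fin (Fintype.card C) × Fin (Fintype.card B)) := fun i =>
      tensorMap ((E.conj hVC h1A).map i) (inducedMap VB)
    have hI₁ : IsFiniteLOCC I₁ := by
      refine IsFiniteLOCC.one I₁ I₁ E.countable
        (Or.inl ⟨E.conj hVC h1A, Equiv.refl _, fun _ => inducedMap VB,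
          fun _ => isChannel_inducedMap hVB, fun _ => rfl⟩)
        (isCoarseGraining_of_equiv (Equiv.refl _) fun _ => rfl)
    have hVBs : VB.conjTranspose.conjTranspose * VB.conjTranspose = 1 := by
      rwa [Matrix.conjTranspose_conjTranspose]
    refine IsFiniteLOCC.link I₁ P I.countable hI₁ ⟨fun _ => F.Θ,
      fun _ j => tensorMap LinearMap.id ((F.conj hVD hVBs).map j), fun _ => Or.inr
        ⟨F.conj hVD hVBs, Equiv.refl _, fun _ => LinearMap.id, fun _ => isChannel_id,
          fun _ => rfl⟩, ?_⟩
    refine isCoarseGraining_of_equiv ((Equiv.sigmaEquivProd _ _).trans e.symm) ?_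
    rintro ⟨i, j⟩
    have hE : (E.conj hVC h1A).map i = (inducedMap VC).comp (E.map i) := by
      change (inducedMap VC).comp ((E.map i).comp (inducedMap 1)) = _
      rw [inducedMap_one, LinearMap.comp_id]
    have hF : ((F.conj hVD hVBs).map j).comp (inducedMap VB) = (inducedMap VD).comp (F.map j) := by
      change ((inducedMap VD).comp ((F.map j).comp (inducedMap VB.conjTranspose))).comp _ = _
      rw [LinearMap.comp_assoc, LinearMap.comp_assoc, inducedMap_comp, hVB, inducedMap_one,
        LinearMap.comp_id]
    simp only [I₁, P, tensorMap_comp, LinearMap.id_comp, hF, hE, Equiv.trans_apply,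
      Equiv.apply_symm_apply]
    rfl
  -- The two-round protocol serves as the constant sequence; on stopping, the relabelling of the
  -- outputs is undone and the distance is exactly zero.
  refine ⟨fun _ => Fintype.card C, fun _ => Fintype.card D, fun _ => I.Θ, fun _ => P,
    fun _ => I.map, fun _ => hP, fun _ => isLOCCLinked_self P, fun _ =>
    ⟨fun _ => inducedMap VC.conjTranspose, fun _ => inducedMap VD.conjTranspose,
      fun _ => isChannel_inducedMap (by rwa [Matrix.conjTranspose_conjTranspose]),
      fun _ => isChannel_inducedMap (by rwa [Matrix.conjTranspose_conjTranspose]),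
      isCoarseGraining_of_equiv (Equiv.refl _) fun i => ?_⟩, ?_⟩
  · simp only [P, tensorMap_comp, ← LinearMap.comp_assoc, inducedMap_comp, hVC, hVD, inducedMap_one,
      LinearMap.id_comp, Equiv.refl_apply, hI]
  · simp [instrumentDist]

theorem LOStar_subset_LOCCStar : LOStar A B C D ⊆ LOCCStar A B C D := by
  rintro F ⟨I, hI, h⟩
  exact ⟨I, loInstruments_subset_loccInstruments hI, h⟩

omit [Fintype A] [DecidableEq A] [Fintype B] [DecidableEq B] [Fintype C] [DecidableEq C]
  [Fintype D] [DecidableEq D] in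
theorem quasiprobExtent_anti {S T : Set (SuperOp A B)} (h : S ⊆ T) (E : SuperOp A B) :
    quasiprobExtent T E ≤ quasiprobExtent S E := by
  refine sInf_le_sInf ?_
  rintro x ⟨m, hm, a, F, hF, hE⟩
  exact ⟨m, hm, a, F, fun i => h (hF i), hE⟩

omit [Fintype A] [DecidableEq A] [Fintype B] [DecidableEq B] [Fintype C] [DecidableEq C]
  [Fintype D] [DecidableEq D] in
theorem quasiprobExtent_le {S : Set (SuperOp A B)} {E : SuperOp A B} {ι : Type*} [Fintype ι]
    [Nonempty ι] {a : ι → ℝ} {F : ι → SuperOp A B} (hF : ∀ i, F i ∈ S)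
    (hE : E = ∑ i, (a i : ℂ) • F i) : quasiprobExtent S E ≤ ENNReal.ofReal (∑ i, |a i|) := by
  let e := (Fintype.equivFin ι).symm
  refine sInf_le ⟨Fintype.card ι, Fintype.card_pos, a ∘ e, F ∘ e, fun i => hF _, ?_, ?_⟩
  · rw [hE]
    exact (e.sum_comp fun i => (a i : ℂ) • F i).symm
  · congr 1
    exact (e.sum_comp fun i => |a i|).symm

/-- The instrument with finitely many outcomes and one Kraus operator for each of them. -/
def QInstrument.ofKraus {n : Type} [Fintype n] (K : n → Matrix A A ℂ)
    (hK : ∑ i, (K i).conjTranspose * K i = 1) : QInstrument A A where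
  Θ := n
  countable := Finite.to_countable
  map i := inducedMap (K i)
  isCP i := isCP_inducedMap (K i)
  sum_isTP := by
    refine ⟨∑ i, inducedMap (K i), fun ω => ?_, fun ω => ?_⟩
    · rw [LinearMap.sum_apply]
      exact hasSum_fintype _
    · rw [LinearMap.sum_apply, Matrix.trace_sum]
      calc ∑ i, (inducedMap (K i) ω).trace = ∑ i, ((K i).conjTranspose * K i * ω).trace :=
            Finset.sum_congr rfl fun i _ => by
              rw [inducedMap_apply, Matrix.trace_mul_comm, ← Matrix.mul_assoc]
        _ = ω.trace := by rw [← Matrix.trace_sum, ← Matrix.sum_mul, hK, Matrix.one_mul]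

/-- The superoperator `X ↦ (V X W† + W X V†) / 2`. -/
noncomputable def hermSandwich (V W : Matrix A A ℂ) : SuperOp A A :=
  (1 / 2 : ℂ) • (sandwich V W + sandwich W V)

/-- The operators `(V + W) / 2` and `(V - W) / 2`. -/
noncomputable def halfSumDiff (V W : Matrix A A ℂ) (b : Bool) : Matrix A A ℂ :=
  (1 / 2 : ℂ) • (V + bif b then W else -W)

/-- The cross terms V†W and W†V cancel between the two signs, leaving (V†V + W†W)/2. -/
theorem sum_halfSumDiff {V W : Matrix A A ℂ} (hV : V ∈ Matrix.unitaryGroup A ℂ)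
    (hW : W ∈ Matrix.unitaryGroup A ℂ) :
    ∑ b, (halfSumDiff V W b).conjTranspose * halfSumDiff V W b = 1 := by
  rw [Matrix.mem_unitaryGroup_iff', Matrix.star_eq_conjTranspose] at hV hW
  simp only [halfSumDiff, Fintype.sum_bool, cond_true, cond_false, Matrix.conjTranspose_smul,
    Matrix.conjTranspose_add, Matrix.conjTranspose_neg, Matrix.smul_mul, Matrix.mul_smul,
    Matrix.add_mul, Matrix.mul_add, Matrix.neg_mul, Matrix.mul_neg, hV, hW]
  have : star (1 / 2 : ℂ) = 1 / 2 := by simp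
  rw [this]
  module

omit [DecidableEq A] in
theorem hermSandwich_eq (V W : Matrix A A ℂ) :
    hermSandwich V W =
      inducedMap (halfSumDiff V W true) - inducedMap (halfSumDiff V W false) := by
  ext1 X
  have : star (1 / 2 : ℂ) = 1 / 2 := by simp
  simp only [hermSandwich, halfSumDiff, cond_true, cond_false, LinearMap.sub_apply,
    LinearMap.smul_apply, LinearMap.add_apply, inducedMap_apply, sandwich_apply,
    Matrix.conjTranspose_smul, this,
    Matrix.conjTranspose_add, Matrix.conjTranspose_neg, Matrix.smul_mul, Matrix.mul_smul,
    Matrix.add_mul, Matrix.mul_add, Matrix.neg_mul, Matrix.mul_neg]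
  module

/-- Both factors are signed sums over two-outcome local instruments; the weight of an outcome pair
is the product of the local signs. -/
theorem tensorMap_hermSandwich_mem_LOStar {V W : Matrix A A ℂ} {V' W' : Matrix B B ℂ}
    (hV : V ∈ Matrix.unitaryGroup A ℂ) (hW : W ∈ Matrix.unitaryGroup A ℂ)
    (hV' : V' ∈ Matrix.unitaryGroup B ℂ) (hW' : W' ∈ Matrix.unitaryGroup B ℂ) :
    tensorMap (hermSandwich V W) (hermSandwich V' W') ∈ LOStar A B A B := by
  have h1 := sum_halfSumDiff hV hW
  have h2 := sum_halfSumDiff hV' hW'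
  let K : Bool × Bool → Matrix (A × B) (A × B) ℂ := fun p =>
    halfSumDiff V W p.1 ⊗ₖ halfSumDiff V' W' p.2
  have hK : ∑ p, (K p).conjTranspose * K p = 1 := by
    simp only [K, Matrix.conjTranspose_kronecker, ← Matrix.mul_kronecker_mul,
      Fintype.sum_prod_type]
    calc _ = (∑ b, (halfSumDiff V W b).conjTranspose * halfSumDiff V W b) ⊗ₖ
          (∑ b, (halfSumDiff V' W' b).conjTranspose * halfSumDiff V' W' b) := by
            simp only [Fintype.sum_bool, Matrix.add_kronecker, Matrix.kronecker_add]
            abel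
      _ = 1 := by rw [h1, h2, Matrix.one_kronecker_one]
  let s : Bool → ℝ := fun b => bif b then 1 else -1
  refine ⟨QInstrument.ofKraus K hK, ⟨QInstrument.ofKraus _ h1, QInstrument.ofKraus _ h2,
    Equiv.refl _, fun p => (tensorMap_inducedMap _ _).symm⟩, fun p => s p.1 * s p.2, ?_, ?_⟩
  · rintro ⟨_ | _, _ | _⟩ <;> norm_num [s]
  · intro ω
    have : tensorMap (hermSandwich V W) (hermSandwich V' W') ω =
        ∑ p : Bool × Bool, ((s p.1 * s p.2 : ℝ) : ℂ) • inducedMap (K p) ω := by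
      simp only [hermSandwich_eq, ← tensorMapBilin_apply, map_sub, LinearMap.sub_apply,
        Fintype.sum_prod_type, Fintype.sum_bool, K, ← tensorMap_inducedMap, s, cond_true,
        cond_false]
      push_cast
      module
    rw [this]
    exact hasSum_fintype fun p : Bool × Bool => ((s p.1 * s p.2 : ℝ) : ℂ) • inducedMap (K p) ω

/-- The first product contains unwanted mixed terms VXW† ⊗ W'YV'† and WXV† ⊗ V'YW'†. The factors i
reverse the relative sign in each tensor factor and contribute i² = −1, so the subtraction cancels
the mixed terms and doubles the others. -/
theorem tensorMap_hermSandwich_sub (V W : Matrix A A ℂ) (V' W' : Matrix B B ℂ) :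
    tensorMap (hermSandwich V W) (hermSandwich V' W') -
      tensorMap (hermSandwich V (Complex.I • W)) (hermSandwich V' (Complex.I • W')) =
    (1 / 2 : ℂ) • (sandwich (V ⊗ₖ V') (W ⊗ₖ W') + sandwich (W ⊗ₖ W') (V ⊗ₖ V')) := by
  refine SuperOp.ext_kronecker fun X Y => ?_
  simp only [hermSandwich, LinearMap.sub_apply, LinearMap.smul_apply, LinearMap.add_apply,
    tensorMap_kronecker, sandwich_apply, Matrix.conjTranspose_kronecker,
    ← Matrix.mul_kronecker_mul, Matrix.conjTranspose_smul, Matrix.smul_mul, Matrix.mul_smul]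
  ext p q
  simp only [Matrix.sub_apply, Matrix.smul_apply, Matrix.add_apply, Matrix.kroneckerMap_apply,
    smul_eq_mul, Complex.star_def, Complex.conj_I]
  linear_combination (-(1 / 4 : ℂ)) *
    (-(V * X * W.conjTranspose) p.1 q.1 + (W * X * V.conjTranspose) p.1 q.1) *
    (-(V' * Y * W'.conjTranspose) p.2 q.2 + (W' * Y * V'.conjTranspose) p.2 q.2) * Complex.I_sq

variable {J : Type*} [Fintype J] [DecidableEq J]

omit [DecidableEq A] [DecidableEq B] in
theorem IsOperatorSchmidt.inducedMap_eq_sum {U : Matrix (A × B) (A × B) ℂ} {u : J → ℝ}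
    {L : J → Matrix A A ℂ} {R : J → Matrix B B ℂ} (h : IsOperatorSchmidt U u L R) :
    inducedMap U = ∑ j, ∑ k, ((u j * u k : ℝ) : ℂ) • sandwich (L j ⊗ₖ R j) (L k ⊗ₖ R k) := by
  ext1 X
  rw [inducedMap_apply, h.eq_sum]
  simp only [Matrix.conjTranspose_sum, Matrix.conjTranspose_smul, Matrix.sum_mul, Matrix.mul_sum,
    Matrix.smul_mul, Matrix.mul_smul, LinearMap.sum_apply, LinearMap.smul_apply, sandwich_apply,
    smul_smul, Finset.smul_sum, Complex.star_def, Complex.conj_ofReal]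
  rw [Finset.sum_comm]
  refine Finset.sum_congr rfl fun j _ => Finset.sum_congr rfl fun k _ => ?_
  push_cast
  rw [mul_comm]

theorem IsOperatorSchmidt.inducedMap_eq_sum_hermSandwich {U : Matrix (A × B) (A × B) ℂ}
    {u : J → ℝ} {L : J → Matrix A A ℂ} {R : J → Matrix B B ℂ} (h : IsOperatorSchmidt U u L R) :
    inducedMap U = ∑ j, ∑ k, ((u j * u k : ℝ) : ℂ) •
      (tensorMap (hermSandwich (L j) (L k)) (hermSandwich (R j) (R k)) -
        tensorMap (hermSandwich (L j) (Complex.I • L k))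
          (hermSandwich (R j) (Complex.I • R k))) := by
  have h1 := h.inducedMap_eq_sum
  have h2 := h1
  rw [Finset.sum_comm] at h2
  simp only [tensorMap_hermSandwich_sub]
  -- Averaging the double sum with its copy under j ↔ k produces the symmetrized terms.
  have h3 : inducedMap U = (1 / 2 : ℂ) • (inducedMap U + inducedMap U) := by module
  rw [h3]
  conv_lhs =>
    congr
    · skip
    · congr
      · rw [h1]
      · rw [h2]
  simp only [← Finset.sum_add_distrib, Finset.smul_sum]
  refine Finset.sum_congr rfl fun j _ => Finset.sum_congr rfl fun k _ => ?_
  rw [mul_comm (u k) (u j)]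
  module

/-- Compare two evaluations of tr U†U; this normalization is the source of the −1 in the upper
bound. -/
theorem IsOperatorSchmidt.sum_sq_eq_one [Nonempty A] [Nonempty B] {U : Matrix (A × B) (A × B) ℂ}
    {u : J → ℝ} {L : J → Matrix A A ℂ} {R : J → Matrix B B ℂ}
    (hU : U ∈ Matrix.unitaryGroup (A × B) ℂ) (h : IsOperatorSchmidt U u L R) :
    ∑ j, u j ^ 2 = 1 := by
  have hA : (Fintype.card A : ℂ) ≠ 0 := by exact_mod_cast Fintype.card_ne_zero
  have hB : (Fintype.card B : ℂ) ≠ 0 := by exact_mod_cast Fintype.card_ne_zero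
  have h1 : (U.conjTranspose * U).trace = Fintype.card A * Fintype.card B := by
    rw [← Matrix.star_eq_conjTranspose, (Matrix.mem_unitaryGroup_iff').mp hU, Matrix.trace_one]
    simp
  have hl := trace_eq_of_hsInner h.orthonormal_left
  have hr := trace_eq_of_hsInner h.orthonormal_right
  rw [h.eq_sum] at h1
  simp only [Matrix.conjTranspose_sum, Matrix.sum_mul, Matrix.mul_sum, Matrix.trace_sum,
    Matrix.mul_smul, Matrix.trace_smul, Matrix.conjTranspose_smul, Matrix.smul_mul,
    Matrix.conjTranspose_kronecker, ← Matrix.mul_kronecker_mul, Matrix.trace_kronecker, hl, hr,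
    Complex.star_def, Complex.conj_ofReal, smul_eq_mul] at h1
  simp only [mul_ite, ite_mul, mul_zero, zero_mul, Finset.mem_univ, if_true,
    Finset.sum_ite_eq'] at h1
  have h2 : (∑ j, (u j : ℂ) ^ 2) * (Fintype.card A * Fintype.card B) =
      1 * (Fintype.card A * Fintype.card B) := by
    rw [Finset.sum_mul, one_mul]
    refine (Finset.sum_congr rfl fun j _ => ?_).trans h1
    ring
  have h3 := mul_right_cancel₀ (mul_ne_zero hA hB) h2
  exact_mod_cast h3

theorem smul_mem_unitaryGroup {c : ℂ} (hc : star c * c = 1) {M : Matrix A A ℂ}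
    (hM : M ∈ Matrix.unitaryGroup A ℂ) : c • M ∈ Matrix.unitaryGroup A ℂ := by
  rw [Matrix.mem_unitaryGroup_iff'] at hM ⊢
  rw [star_smul, Matrix.smul_mul, Matrix.mul_smul, hM, smul_smul, hc, one_smul]

theorem I_smul_mem_unitaryGroup {M : Matrix A A ℂ} (hM : M ∈ Matrix.unitaryGroup A ℂ) :
    Complex.I • M ∈ Matrix.unitaryGroup A ℂ :=
  smul_mem_unitaryGroup (by simp) hM

theorem IsOperatorSchmidt.quasiprobExtent_LOStar_le [Nonempty A] [Nonempty B]
    {U : Matrix (A × B) (A × B) ℂ} {u : J → ℝ} {L : J → Matrix A A ℂ} {R : J → Matrix B B ℂ}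
    (hU : U ∈ Matrix.unitaryGroup (A × B) ℂ) (h : IsOperatorSchmidt U u L R)
    (hL : ∀ j, L j ∈ Matrix.unitaryGroup A ℂ) (hR : ∀ j, R j ∈ Matrix.unitaryGroup B ℂ) :
    quasiprobExtent (LOStar A B A B) (inducedMap U) ≤
      ENNReal.ofReal (2 * (∑ j, u j) ^ 2 - 1) := by
  have hsq := h.sum_sq_eq_one hU
  have hJ : Nonempty J := by
    by_contra hJ
    rw [not_nonempty_iff] at hJ
    simp at hsq
  -- Each pair (j,k) contributes a positive and a negative product. The negative one vanishes for j
  -- = k, so its coefficient is set to 0 there; this saves ∑ uⱼ² = 1.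
  let a : (J × J) × Bool → ℝ := fun p =>
    bif p.2 then u p.1.1 * u p.1.2 else if p.1.1 = p.1.2 then 0 else -(u p.1.1 * u p.1.2)
  let F : (J × J) × Bool → SuperOp (A × B) (A × B) := fun p =>
    bif p.2 then tensorMap (hermSandwich (L p.1.1) (L p.1.2)) (hermSandwich (R p.1.1) (R p.1.2))
    else tensorMap (hermSandwich (L p.1.1) (Complex.I • L p.1.2))
      (hermSandwich (R p.1.1) (Complex.I • R p.1.2))
  have hF : ∀ p, F p ∈ LOStar A B A B := by
    rintro ⟨p, _ | _⟩
    · exact tensorMap_hermSandwich_mem_LOStar (hL _) (I_smul_mem_unitaryGroup (hL _)) (hR _)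
        (I_smul_mem_unitaryGroup (hR _))
    · exact tensorMap_hermSandwich_mem_LOStar (hL _) (hL _) (hR _) (hR _)
  have hE : inducedMap U = ∑ p, (a p : ℂ) • F p := by
    rw [h.inducedMap_eq_sum_hermSandwich, Fintype.sum_prod_type, Fintype.sum_prod_type]
    refine Finset.sum_congr rfl fun j _ => Finset.sum_congr rfl fun k _ => ?_
    simp only [Fintype.sum_bool, a, F, cond_true, cond_false]
    split_ifs with hjk
    · have h0 : hermSandwich (L j) (Complex.I • L j) = 0 := by
        ext1 X
        simp [hermSandwich, sandwich_apply]
      rw [← hjk, h0, ← tensorMapBilin_apply, ← tensorMapBilin_apply]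
      simp
    · push_cast
      module
  refine (quasiprobExtent_le hF hE).trans_eq ?_
  congr 1
  rw [Fintype.sum_prod_type, Fintype.sum_prod_type]
  have hterm : ∀ j k, ∑ b, |a ((j, k), b)| = 2 * (u j * u k) - if j = k then u j ^ 2 else 0 := by
    intro j k
    have := mul_pos (h.pos j) (h.pos k)
    simp only [Fintype.sum_bool, a, cond_true, cond_false, abs_of_pos this]
    split_ifs with hjk
    · rw [← hjk]
      simp
      ring
    · rw [abs_neg, abs_of_pos this]
      ring
  simp only [hterm, Finset.sum_sub_distrib, Finset.sum_ite_eq, Finset.mem_univ, if_true, hsq]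
  rw [sq, Finset.sum_mul_sum]
  simp only [Finset.mul_sum]

end LocalOperations

/-! ### Singular value decomposition with real singular vectors -/

section RealSVD

open scoped Matrix

variable {n : Type*} [Fintype n] [DecidableEq n]

/-- Commuting real symmetric matrices have a joint orthonormal eigenbasis. -/
theorem Matrix.exists_joint_orthonormal_eigenbasis {ι : Type*} {T : ι → Matrix n n ℝ}
    (hT : ∀ i, (T i).IsHermitian) (hC : Pairwise fun i j => Commute (T i) (T j)) :
    ∃ (b : n → n → ℝ) (μ : ι → n → ℝ), (∀ k l, b k ⬝ᵥ b l = if k = l then 1 else 0) ∧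
      ∀ i k, T i *ᵥ b k = μ i k • b k := by
  classical
  let T' : ι → EuclideanSpace ℝ n →ₗ[ℝ] EuclideanSpace ℝ n := fun i => Matrix.toEuclideanLin (T i)
  have hT' : ∀ i, (T' i).IsSymmetric := fun i => Matrix.isSymmetric_toEuclideanLin_iff.mpr (hT i)
  have hC' : Pairwise (Function.onFun Commute T') := by
    intro i j hij
    have h := (hC hij).eq
    ext v : 1
    change Matrix.toEuclideanLin (T i) (Matrix.toEuclideanLin (T j) v) =
      Matrix.toEuclideanLin (T j) (Matrix.toEuclideanLin (T i) v)
    simp only [Matrix.toLpLin_apply, Matrix.mulVec_mulVec, h]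
  let V : (ι → ℝ) → Submodule ℝ (EuclideanSpace ℝ n) := fun χ =>
    ⨅ i, Module.End.eigenspace (T' i) (χ i)
  have hV : DirectSum.IsInternal V :=
    LinearMap.IsSymmetric.directSum_isInternal_of_pairwise_commute hT' hC'
  have hO : OrthogonalFamily ℝ (fun χ => V χ) fun χ => (V χ).subtypeₗᵢ :=
    LinearMap.IsSymmetric.orthogonalFamily_iInf_eigenspaces hT'
  -- The candidate eigenvalue tuples form an infinite type; restricting to nonzero joint eigenspaces
  -- gives the finite family needed to assemble an orthonormal basis.
  have hfin : Finite {χ // V χ ≠ ⊥} :=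
    WellFoundedGT.finite_ne_bot_of_iSupIndep hV.submodule_iSupIndep
  have := Fintype.ofFinite {χ // V χ ≠ ⊥}
  have hV' := DirectSum.isInternal_ne_bot_iff.mpr hV
  have hO' : OrthogonalFamily ℝ (fun χ : {χ // V χ ≠ ⊥} => V χ) fun χ => (V χ).subtypeₗᵢ :=
    hO.comp Subtype.val_injective
  have hrank : Module.finrank ℝ (EuclideanSpace ℝ n) = Fintype.card n := finrank_euclideanSpace
  let e := Fintype.equivFin n
  let b := hV'.subordinateOrthonormalBasis hrank hO'
  refine ⟨fun k => (b (e k)).ofLp,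
    fun i k => (hV'.subordinateOrthonormalBasisIndex hrank (e k) hO').1 i, ?_, ?_⟩
  · intro k l
    have h := orthonormal_iff_ite.mp b.orthonormal (e k) (e l)
    rw [EuclideanSpace.inner_eq_star_dotProduct] at h
    simp only [e.injective.eq_iff] at h
    rw [← h, dotProduct_comm]
    rfl
  · intro i k
    have h := hV'.subordinateOrthonormalBasis_subordinate hrank (e k) hO'
    have h2 := Module.End.mem_eigenspace_iff.mp ((Submodule.mem_iInf _).mp h i)
    exact congrArg WithLp.ofLp h2

omit [DecidableEq n] in
-- The real part of p†p − pᵀp equals 2 ∑ (Im pₖ)².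
theorem im_eq_zero_of_dotProduct_eq {p : n → ℂ} (h1 : star p ⬝ᵥ p = 1) (h2 : p ⬝ᵥ p = 1) (k : n) :
    (p k).im = 0 := by
  have h : ∑ k, 2 * (p k).im ^ 2 = 0 := by
    have h3 := congrArg Complex.re (h1.trans h2.symm)
    simp only [dotProduct, Complex.re_sum, Pi.star_apply, Complex.star_def, Complex.mul_re,
      Complex.conj_re, Complex.conj_im] at h3
    rw [← sub_eq_zero, ← Finset.sum_sub_distrib] at h3
    rw [← h3]
    exact Finset.sum_congr rfl fun k _ => by ring
  rw [Finset.sum_eq_zero_iff_of_nonneg fun k _ => by positivity] at h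
  simpa using h k (Finset.mem_univ k)

/-- If `C` is a complex matrix for which `C C†` and `C† C` are real, then a real orthonormal basis
is mapped by `C` to multiples of the vectors of a real orthonormal family. -/
theorem Matrix.exists_real_eigenbasis_of_conj_eq {C : Matrix n n ℂ}
    (h1 : C * C.conjTranspose = C.map star * C.transpose)
    (h2 : C.conjTranspose * C = C.transpose * C.map star) :
    ∃ (q : n → n → ℝ) (κ : n → ℝ) (s : n → ℂ),
      (∀ k l, q k ⬝ᵥ q l = if k = l then 1 else 0) ∧
      (∀ k l, star (C *ᵥ fun a => (q k a : ℂ)) ⬝ᵥ (C *ᵥ fun a => (q l a : ℂ)) =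
        if k = l then (κ k : ℂ) else 0) ∧
      (∀ k l, (C *ᵥ fun a => (q k a : ℂ)) ⬝ᵥ (C *ᵥ fun a => (q l a : ℂ)) =
        if k = l then s k else 0) ∧
      ∀ k, star (s k) * s k = (κ k : ℂ) ^ 2 := by
  set Ch := C.conjTranspose with hCh
  set Ct := C.transpose with hCt
  set Cb := C.map star with hCb
  -- T is the entrywise conjugate of S, and K = C†C is real and symmetric by hypothesis. The two
  -- reality hypotheses give ST = TS = K² and make K commute with both, so K, Re S and Im S are
  -- commuting real symmetric matrices with a joint real eigenbasis.
  let S := Ct * C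
  let T := Ch * Cb
  let K := Ch * C
  have hST : S * T = K * K := by
    calc S * T = Ct * (C * Ch) * Cb := by simp only [S, T, Matrix.mul_assoc]
      _ = (Ct * Cb) * (Ct * Cb) := by rw [h1]; simp only [Matrix.mul_assoc]
      _ = K * K := by rw [← h2]
  have hTS : T * S = K * K := by
    calc T * S = Ch * (Cb * Ct) * C := by simp only [S, T, Matrix.mul_assoc]
      _ = K * K := by rw [← h1]; simp only [K, Matrix.mul_assoc]
  have hKS : Commute K S := by
    change K * S = S * K
    calc K * S = Ct * (Cb * Ct) * C := by simp only [K, h2, S, Matrix.mul_assoc]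
      _ = S * K := by rw [← h1]; simp only [S, K, Matrix.mul_assoc]
  have hKT : Commute K T := by
    change K * T = T * K
    calc K * T = Ch * (C * Ch) * Cb := by simp only [K, T, Matrix.mul_assoc]
      _ = T * (Ct * Cb) := by rw [h1]; simp only [T, Matrix.mul_assoc]
      _ = T * K := by rw [← h2]
  have hTSc : Commute S T := hST.trans hTS.symm
  have hTij : ∀ i j, T i j = star (S i j) := by
    intro i j
    simp [S, T, hCh, hCb, hCt, Matrix.mul_apply]
  have hSsymm : ∀ i j, S j i = S i j := by
    intro i j
    simp [S, hCt, Matrix.mul_apply, mul_comm]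
  have hKreal : ∀ i j, star (K i j) = K i j := by
    intro i j
    conv_rhs => rw [show K = Ct * Cb from h2]
    simp [K, hCh, hCb, hCt, Matrix.mul_apply]
  have hKsymm : ∀ i j, K j i = K i j := by
    intro i j
    rw [← hKreal i j]
    simp [K, hCh, Matrix.mul_apply, mul_comm]
  let R : Fin 3 → Matrix n n ℝ := ![K.map Complex.re, S.map Complex.re, S.map Complex.im]
  have hR0 : (R 0).map Complex.ofRealHom = K := by
    ext i j
    exact Complex.conj_eq_iff_re.mp (hKreal i j)
  have hR1 : (R 1).map Complex.ofRealHom = (1 / 2 : ℂ) • (S + T) := by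
    ext i j
    rw [Matrix.smul_apply, Matrix.add_apply, hTij, smul_eq_mul, Complex.star_def, Complex.add_conj]
    simp [R]
  have hR2 : (R 2).map Complex.ofRealHom = (-Complex.I / 2 : ℂ) • (S - T) := by
    ext i j
    rw [Matrix.smul_apply, Matrix.sub_apply, hTij, smul_eq_mul, Complex.star_def, Complex.sub_conj]
    simp only [R, Matrix.map_apply]
    change (((S i j).im : ℝ) : ℂ) = _
    push_cast
    linear_combination ((S i j).im : ℂ) * Complex.I_sq
  have hSR : S = (R 1).map Complex.ofRealHom + Complex.I • (R 2).map Complex.ofRealHom := by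
    rw [hR1, hR2, smul_smul]
    have : Complex.I * (-Complex.I / 2) = 1 / 2 := by linear_combination (-1 / 2) * Complex.I_sq
    rw [this]
    module
  have hTR : T = (R 1).map Complex.ofRealHom - Complex.I • (R 2).map Complex.ofRealHom := by
    rw [hR1, hR2, smul_smul]
    have : Complex.I * (-Complex.I / 2) = 1 / 2 := by linear_combination (-1 / 2) * Complex.I_sq
    rw [this]
    module
  have hcomm : ∀ i j, Commute ((R i).map Complex.ofRealHom) ((R j).map Complex.ofRealHom) →
      Commute (R i) (R j) := by
    intro i j h
    apply Matrix.map_injective Complex.ofRealHom.injective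
    change (R i * R j).map Complex.ofRealHom = (R j * R i).map Complex.ofRealHom
    rw [Matrix.map_mul, Matrix.map_mul]
    exact h
  have h01 : Commute (R 0) (R 1) := hcomm _ _ (by
    rw [hR0, hR1]; exact (hKS.add_right hKT).smul_right _)
  have h02 : Commute (R 0) (R 2) := hcomm _ _ (by
    rw [hR0, hR2]; exact (hKS.sub_right hKT).smul_right _)
  have h12 : Commute (R 1) (R 2) := hcomm _ _ (by
    rw [hR1, hR2]
    exact ((((Commute.refl S).sub_right hTSc).add_left
      (hTSc.symm.sub_right (Commute.refl T))).smul_right _).smul_left _)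
  have hherm : ∀ i, (R i).IsHermitian := by
    intro i
    fin_cases i <;> ext a b <;> simp [R, hKsymm a b, hSsymm a b]
  have hpair : Pairwise fun i j => Commute (R i) (R j) := by
    intro i j hij
    fin_cases i <;> fin_cases j <;> first
      | exact absurd rfl hij | exact h01 | exact h02 | exact h12 | exact h01.symm
      | exact h02.symm | exact h12.symm
  obtain ⟨q, μ, hq, hμ⟩ := Matrix.exists_joint_orthonormal_eigenbasis hherm hpair
  let qc : n → n → ℂ := fun k a => (q k a : ℂ)
  have hqc : ∀ k l, qc k ⬝ᵥ qc l = if k = l then 1 else 0 := by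
    intro k l
    have := congrArg (fun x : ℝ => (x : ℂ)) (hq k l)
    simp only [dotProduct] at this ⊢
    push_cast at this
    rw [apply_ite Complex.ofReal] at this
    simpa [qc] using this
  have hμc : ∀ i k, (R i).map Complex.ofRealHom *ᵥ qc k = (μ i k : ℂ) • qc k := by
    intro i k
    ext a
    have := congrArg Complex.ofRealHom (congrFun (hμ i k) a)
    rw [RingHom.map_mulVec] at this
    simpa [qc, Function.comp_def] using this
  let s : n → ℂ := fun k => μ 1 k + Complex.I * μ 2 k
  have hK : ∀ k, K *ᵥ qc k = (μ 0 k : ℂ) • qc k := fun k => by rw [← hR0, hμc]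
  have hS : ∀ k, S *ᵥ qc k = s k • qc k := fun k => by
    rw [hSR, Matrix.add_mulVec, Matrix.smul_mulVec, hμc, hμc, smul_smul, ← add_smul]
  have hT : ∀ k, T *ᵥ qc k = star (s k) • qc k := fun k => by
    rw [hTR, Matrix.sub_mulVec, Matrix.smul_mulVec, hμc, hμc, smul_smul, ← sub_smul]
    simp [s, sub_eq_add_neg]
  have hsq : ∀ k, star (qc k) = qc k := fun k => by
    ext a
    simp [qc]
  refine ⟨q, μ 0, s, hq, fun k l => ?_, fun k l => ?_, fun k => ?_⟩
  · change star (C *ᵥ qc k) ⬝ᵥ (C *ᵥ qc l) = _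
    rw [Matrix.star_mulVec, ← Matrix.dotProduct_mulVec, Matrix.mulVec_mulVec, hsq]
    change qc k ⬝ᵥ (K *ᵥ qc l) = _
    rw [hK, dotProduct_smul, hqc]
    split_ifs with h <;> simp [h]
  · change (C *ᵥ qc k) ⬝ᵥ (C *ᵥ qc l) = _
    rw [← Matrix.vecMul_transpose, ← Matrix.dotProduct_mulVec, Matrix.mulVec_mulVec]
    change qc k ⬝ᵥ (S *ᵥ qc l) = _
    rw [hS, dotProduct_smul, hqc]
    split_ifs with h <;> simp [h]
  -- Evaluating TS = K² on a joint eigenvector turns it into |sₖ|² = κₖ².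
  · have h := congrArg (fun M => qc k ⬝ᵥ (M *ᵥ qc k)) hTS
    simp only [← Matrix.mulVec_mulVec, hS, hK, hT, Matrix.mulVec_smul, dotProduct_smul, hqc,
      if_true, smul_eq_mul, mul_one] at h
    rw [sq, ← h, mul_comm]

/-- A complex matrix `C` for which `C C†` and `C† C` are real has a singular value decomposition
whose singular vectors are real up to phases. -/
theorem Matrix.exists_real_singular_vectors {C : Matrix n n ℂ}
    (h1 : C * C.conjTranspose = C.map star * C.transpose)
    (h2 : C.conjTranspose * C = C.transpose * C.map star) :
    ∃ (r : ℕ) (σ : Fin r → ℝ) (z : Fin r → ℂ) (p q : Fin r → n → ℝ),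
      (∀ j, 0 < σ j) ∧ (∀ j, star (z j) * z j = 1) ∧
      (∀ j k, p j ⬝ᵥ p k = if j = k then 1 else 0) ∧
      (∀ j k, q j ⬝ᵥ q k = if j = k then 1 else 0) ∧
      ∀ a b, C a b = ∑ j, (σ j : ℂ) * (z j * p j a * q j b) := by
  obtain ⟨q, κ, s, hq, hκ, hs, hsκ⟩ := Matrix.exists_real_eigenbasis_of_conj_eq h1 h2
  let v : n → n → ℂ := fun k => C *ᵥ fun a => (q k a : ℂ)
  have hκ' : ∀ k l, star (v k) ⬝ᵥ v l = if k = l then (κ k : ℂ) else 0 := hκ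
  have hs' : ∀ k l, v k ⬝ᵥ v l = if k = l then s k else 0 := hs
  have hκ0 : ∀ k, 0 ≤ κ k := by
    intro k
    have h : (0 : ℂ) ≤ (κ k : ℂ) := by
      have := hκ' k k
      rw [if_pos rfl] at this
      rw [← this]
      exact dotProduct_star_self_nonneg _
    exact_mod_cast h
  have hCv : ∀ a b, C a b = ∑ k, v k a * q k b := by
    -- Orthonormal rows of a square matrix give orthonormal columns, so ∑ₖ qₖqₖᵀ = 1 and C = ∑ₖ
    -- (Cqₖ)qₖᵀ.
    have hM : (Matrix.of q) * (Matrix.of q)ᵀ = 1 := by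
      ext k l
      simpa [Matrix.mul_apply, Matrix.one_apply, dotProduct] using hq k l
    have hM' : (Matrix.of q)ᵀ * Matrix.of q = 1 := mul_eq_one_comm.mp hM
    intro a b
    have hqt : ∀ c, ∑ k, (q k c : ℂ) * q k b = if c = b then 1 else 0 := by
      intro c
      have := congrArg Complex.ofReal (congrFun (congrFun hM' c) b)
      simp only [Matrix.mul_apply, Matrix.transpose_apply, Matrix.of_apply, Matrix.one_apply] at this
      push_cast at this
      rw [this]
      split_ifs <;> simp
    simp only [v, Matrix.mulVec, dotProduct, Finset.sum_mul]
    rw [Finset.sum_comm]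
    simp only [mul_assoc, ← Finset.mul_sum, hqt]
    simp
  have hv0 : ∀ k, κ k = 0 → v k = 0 := by
    intro k hk
    have := hκ' k k
    rw [if_pos rfl, hk, Complex.ofReal_zero] at this
    exact dotProduct_star_self_eq_zero.mp this
  -- The phase of Cqₖ is a square root of sₖ/κₖ, which has modulus 1 because |sₖ| = κₖ.
  have hz : ∀ k, ∃ z : ℂ, κ k ≠ 0 → star z * z = 1 ∧ z ^ 2 * κ k = s k := by
    intro k
    obtain ⟨z, hz⟩ := IsAlgClosed.exists_pow_nat_eq (s k / κ k) (n := 2) (by norm_num)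
    refine ⟨z, fun hk => ?_⟩
    have hkc : (κ k : ℂ) ≠ 0 := by exact_mod_cast hk
    have hz2 : z ^ 2 * κ k = s k := by rw [hz, div_mul_cancel₀ _ hkc]
    refine ⟨?_, hz2⟩
    have h4 : (star z * z) ^ 2 = 1 := by
      have := hsκ k
      rw [← hz2] at this
      simp only [star_mul', star_pow, Complex.star_def, Complex.conj_ofReal] at this ⊢
      have h5 : ((starRingEnd ℂ z * z) ^ 2) * (κ k : ℂ) ^ 2 = 1 * (κ k : ℂ) ^ 2 := by
        linear_combination this
      exact mul_right_cancel₀ (pow_ne_zero 2 hkc) h5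
    have h6 : star z * z = ((‖z‖ ^ 2 : ℝ) : ℂ) := by
      rw [Complex.star_def, Complex.conj_mul']; norm_cast
    rw [h6] at h4 ⊢
    have h7 : (‖z‖ ^ 2) ^ 2 = 1 := by exact_mod_cast h4
    have h8 : ‖z‖ ^ 2 = 1 := (pow_eq_one_iff_of_nonneg (by positivity) (by norm_num)).mp h7
    rw [h8]; simp
  choose z hz1 using hz
  -- After removal of phase and norm, both w†w and wᵀw equal 1 when κₖ ≠ 0, which forces w to be
  -- real.
  let w : n → n → ℂ := fun k => (star (z k) * ((Real.sqrt (κ k))⁻¹ : ℝ)) • v k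
  have hsqrt : ∀ k, κ k ≠ 0 → (((Real.sqrt (κ k))⁻¹ : ℝ) : ℂ) ^ 2 * κ k = 1 := by
    intro k hk
    rw [← Complex.ofReal_pow, inv_pow, Real.sq_sqrt (hκ0 k), ← Complex.ofReal_mul,
      inv_mul_cancel₀ hk, Complex.ofReal_one]
  have hw1 : ∀ k l, κ k ≠ 0 → star (w k) ⬝ᵥ w l = if k = l then 1 else 0 := by
    intro k l hk
    simp only [w, star_smul, smul_dotProduct, dotProduct_smul, hκ']
    split_ifs with h
    · subst h
      simp only [star_mul', Complex.star_def, Complex.conj_ofReal, smul_eq_mul,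
        Complex.conj_conj]
      have h3 := (hz1 k hk).1
      rw [Complex.star_def] at h3
      linear_combination (starRingEnd ℂ (z k) * z k) * hsqrt k hk + h3
    · simp
  have hw2 : ∀ k, κ k ≠ 0 → w k ⬝ᵥ w k = 1 := by
    intro k hk
    simp only [w, smul_dotProduct, dotProduct_smul, hs', if_true, smul_eq_mul, ← (hz1 k hk).2]
    linear_combination ((star (z k) * z k) ^ 2) * hsqrt k hk +
      (star (z k) * z k + 1) * (hz1 k hk).1
  have hwre : ∀ k, κ k ≠ 0 → ∀ a, ((w k a).re : ℂ) = w k a := by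
    intro k hk a
    have h0 := hw1 k k hk
    rw [if_pos rfl] at h0
    have := im_eq_zero_of_dotProduct_eq h0 (hw2 k hk) a
    exact Complex.ext (by simp) (by simp [this])
  -- Only nonzero singular values are kept, since Schmidt coefficients must be positive; the dropped
  -- terms have Cqₖ = 0.
  let e := (Fintype.equivFin {k // κ k ≠ 0}).symm
  refine ⟨_, fun j => Real.sqrt (κ (e j)), fun j => z (e j), fun j a => (w (e j) a).re,
    fun j => q (e j), ?_, fun j => (hz1 _ (e j).2).1, ?_, ?_, ?_⟩
  · exact fun j => Real.sqrt_pos.mpr (lt_of_le_of_ne (hκ0 _) (e j).2.symm)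
  · intro j k
    have h := hw1 (e j) (e k) (e j).2
    simp only [Subtype.coe_inj, e.injective.eq_iff] at h
    apply Complex.ofReal_injective
    simp only [dotProduct] at h ⊢
    push_cast
    simp only [hwre _ (e j).2, hwre _ (e k).2]
    rw [apply_ite Complex.ofReal, Complex.ofReal_one, Complex.ofReal_zero, ← h]
    refine Finset.sum_congr rfl fun a _ => ?_
    rw [Pi.star_apply, ← hwre _ (e j).2 a, Complex.star_def, Complex.conj_ofReal]
  · intro j k
    simp only [hq, Subtype.coe_inj, e.injective.eq_iff]
  · intro a b
    have h3 : ∀ k, κ k ≠ 0 → (Real.sqrt (κ k) : ℂ) * (z k * w k a * q k b) = v k a * q k b := by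
      intro k hk
      have h4 : (Real.sqrt (κ k) : ℂ) ≠ 0 := by
        exact_mod_cast (Real.sqrt_pos.mpr (lt_of_le_of_ne (hκ0 k) hk.symm)).ne'
      simp only [w, Pi.smul_apply, smul_eq_mul, Complex.ofReal_inv]
      field_simp
      linear_combination (v k a * q k b) * (hz1 k hk).1
    rw [hCv]
    simp only [hwre _ (e _).2, h3 _ (e _).2]
    rw [e.sum_comp fun k : {k // κ k ≠ 0} => v k a * (q k b : ℂ)]
    rw [← Finset.sum_subtype (Finset.univ.filter fun k => κ k ≠ 0) (by simp)
      fun k => v k a * (q k b : ℂ), Finset.sum_filter_of_ne]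
    intro k _ hk h0
    exact hk (by rw [hv0 k h0]; simp)

end RealSVD

/-! ### Two-qubit unitaries in the quaternion basis -/

section TwoQubits

/-- The basis `1, iX, iY, iZ` of the `2 × 2` matrices. -/
noncomputable def quatBasis : Fin 4 → Matrix (Fin 2) (Fin 2) ℂ :=
  ![1, !![0, Complex.I; Complex.I, 0], !![0, 1; -1, 0], !![Complex.I, 0; 0, -Complex.I]]

theorem trace_quatBasis (j k : Fin 4) :
    ((quatBasis j).conjTranspose * quatBasis k).trace = if j = k then 2 else 0 := by
  fin_cases j <;> fin_cases k <;>
    simp [quatBasis, Matrix.trace, Matrix.mul_apply, Fin.sum_univ_two] <;> norm_num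

theorem conjTranspose_quatBasis (j : Fin 4) : (quatBasis j).conjTranspose =
    ![1, !![0, -Complex.I; -Complex.I, 0], !![0, -1; 1, 0],
      !![-Complex.I, 0; 0, Complex.I]] j := by
  ext a b
  fin_cases j <;> fin_cases a <;> fin_cases b <;> simp [quatBasis]

theorem sum_smul_quatBasis (G : Fin 4 → ℂ) :
    ∑ k, G k • quatBasis k = !![G 0 + G 3 * Complex.I, G 1 * Complex.I + G 2;
      G 1 * Complex.I - G 2, G 0 - G 3 * Complex.I] := by
  ext a b
  fin_cases a <;> fin_cases b <;>
    simp [quatBasis, Fin.sum_univ_four, sub_eq_add_neg]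

theorem exists_eq_sum_smul_quatBasis (X : Matrix (Fin 2) (Fin 2) ℂ) :
    ∃ G : Fin 4 → ℂ, X = ∑ k, G k • quatBasis k := by
  -- The coefficients are tr(Qₖ†X)/2 for the quaternion basis (Qₖ).
  refine ⟨![(X 0 0 + X 1 1) / 2, -Complex.I * (X 0 1 + X 1 0) / 2, (X 0 1 - X 1 0) / 2,
    -Complex.I * (X 0 0 - X 1 1) / 2], ?_⟩
  rw [sum_smul_quatBasis]
  ext a b
  fin_cases a <;> fin_cases b <;> simp
  · linear_combination ((X 0 0 - X 1 1) / 2) * Complex.I_sq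
  · linear_combination ((X 0 1 + X 1 0) / 2) * Complex.I_sq
  · linear_combination ((X 0 1 + X 1 0) / 2) * Complex.I_sq
  · linear_combination (-(X 0 0 - X 1 1) / 2) * Complex.I_sq

/-- For a cyclic triple (m, n, k) of imaginary units, the coefficient of Qₘ in either identity
combines G₀ₘ − Gₘ₀ with ±(Gₙₖ − Gₖₙ). Reversing the order of multiplication flips only the second
sign, because distinct imaginary units anticommute, so both differences vanish. -/
theorem symm_of_sum_smul_quatBasis_eq_one {G : Fin 4 → Fin 4 → ℂ}
    (h1 : ∑ j, ∑ l, G j l • ((quatBasis j).conjTranspose * quatBasis l) = 1)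
    (h2 : ∑ j, ∑ l, G j l • (quatBasis l * (quatBasis j).conjTranspose) = 1) (j l : Fin 4) :
    G j l = G l j := by
  simp only [conjTranspose_quatBasis] at h1 h2
  have e := fun a b => congrFun (congrFun h1 a) b
  have f := fun a b => congrFun (congrFun h2 a) b
  have e00 := e 0 0
  have e01 := e 0 1
  have e10 := e 1 0
  have e11 := e 1 1
  have f00 := f 0 0
  have f01 := f 0 1
  have f10 := f 1 0
  have f11 := f 1 1
  clear e f h1 h2
  simp [quatBasis, Matrix.mul_apply, Fin.sum_univ_two, Fin.sum_univ_four, Matrix.sum_apply]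
    at e00 e01 e10 e11 f00 f01 f10 f11
  have g01 : G 0 1 = G 1 0 := by
    linear_combination (-Complex.I / 4) * (e01 + e10 + f01 + f10) + (G 0 1 - G 1 0) * Complex.I_sq
  have g23 : G 2 3 = G 3 2 := by
    linear_combination (-Complex.I / 4) * (e01 + e10 - f01 - f10) + (G 2 3 - G 3 2) * Complex.I_sq
  have g02 : G 0 2 = G 2 0 := by
    linear_combination (1 / 4) * (e01 - e10 + f01 - f10)
  have g13 : G 1 3 = G 3 1 := by
    linear_combination (-1 / 4) * (e01 - e10 - f01 + f10)
  have g03 : G 0 3 = G 3 0 := by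
    linear_combination (-Complex.I / 4) * (e00 - e11 + f00 - f11) + (G 0 3 - G 3 0) * Complex.I_sq
  have g12 : G 1 2 = G 2 1 := by
    linear_combination (-Complex.I / 4) * (e00 - e11 - f00 + f11) + (G 1 2 - G 2 1) * Complex.I_sq
  fin_cases j <;> fin_cases l <;> first
    | rfl | exact g01 | exact g02 | exact g03 | exact g12 | exact g13 | exact g23
    | exact g01.symm | exact g02.symm | exact g03.symm | exact g12.symm | exact g13.symm
    | exact g23.symm

/-- Unit quaternions form SU(2). -/
theorem sum_smul_quatBasis_mem_unitaryGroup {p : Fin 4 → ℝ} (hp : p ⬝ᵥ p = 1) :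
    ∑ k, (p k : ℂ) • quatBasis k ∈ Matrix.unitaryGroup (Fin 2) ℂ := by
  have h : (p 0 : ℂ) * p 0 + p 1 * p 1 + p 2 * p 2 + p 3 * p 3 = 1 := by
    have := congrArg Complex.ofReal hp
    simpa [dotProduct, Fin.sum_univ_four] using this
  rw [Matrix.mem_unitaryGroup_iff', sum_smul_quatBasis]
  ext a b
  fin_cases a <;> fin_cases b <;>
    simp [Matrix.mul_apply, Fin.sum_univ_two]
  · linear_combination h - ((p 3 : ℂ) ^ 2 + (p 1 : ℂ) ^ 2) * Complex.I_sq
  · ring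
  · ring
  · linear_combination h - ((p 3 : ℂ) ^ 2 + (p 1 : ℂ) ^ 2) * Complex.I_sq

theorem hsInner_sum_smul_quatBasis (p q : Fin 4 → ℝ) :
    hsInner (∑ k, (p k : ℂ) • quatBasis k) (∑ k, (q k : ℂ) • quatBasis k) =
      ((p ⬝ᵥ q : ℝ) : ℂ) := by
  simp only [hsInner, Matrix.conjTranspose_sum, Matrix.sum_mul, Matrix.mul_sum, Matrix.trace_sum,
    Matrix.conjTranspose_smul, Matrix.smul_mul, Matrix.mul_smul, Matrix.trace_smul, trace_quatBasis,
    dotProduct, Complex.star_def, Complex.conj_ofReal]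
  simp only [mul_ite, mul_zero, Finset.sum_ite_eq', Finset.mem_univ, if_true, smul_eq_mul]
  rw [Finset.sum_div, Fintype.card_fin]
  push_cast
  exact Finset.sum_congr rfl fun k _ => by ring

/-- The partial trace over the second factor of a sum of Kronecker products. -/
theorem sum_trace_smul_eq_of_sum_kronecker_eq_one {ι : Type*} [Fintype ι]
    {X Y : ι → Matrix (Fin 2) (Fin 2) ℂ} (h : ∑ i, X i ⊗ₖ Y i = 1) :
    ∑ i, ((Y i).trace / 2) • X i = 1 := by
  ext a b
  have h' := fun c => congrFun (congrFun h (a, c)) (b, c)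
  simp only [Matrix.sum_apply, Matrix.kroneckerMap_apply] at h'
  simp only [Matrix.sum_apply, Matrix.smul_apply, smul_eq_mul, Matrix.trace, Matrix.diag,
    Fin.sum_univ_two]
  have h0 := h' 0
  have h1 := h' 1
  have e : ∀ c : Fin 2, (1 : Matrix (Fin 2 × Fin 2) (Fin 2 × Fin 2) ℂ) (a, c) (b, c) =
      (1 : Matrix (Fin 2) (Fin 2) ℂ) a b := by
    intro c
    simp [Matrix.one_apply]
  rw [e] at h0 h1
  have h2 : ∑ i, (Y i 0 0 + Y i 1 1) / 2 * X i a b =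
      (1 / 2) * ∑ i, X i a b * Y i 0 0 + (1 / 2) * ∑ i, X i a b * Y i 1 1 := by
    rw [Finset.mul_sum, Finset.mul_sum, ← Finset.sum_add_distrib]
    exact Finset.sum_congr rfl fun i _ => by ring
  rw [h2, h0, h1]
  ring

/-- The normalized partial traces of U†U = 1 and UU† = 1 over the second qubit are the two
identities required by `symm_of_sum_smul_quatBasis_eq_one`, with G the transpose of CC†. Symmetry
together with hermiticity says that CC† is real. -/
theorem sum_star_mul_symm_of_unitary {c : Fin 4 → Fin 4 → ℂ}
    (h : ∑ j, ∑ k, c j k • (quatBasis j ⊗ₖ quatBasis k) ∈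
      Matrix.unitaryGroup (Fin 2 × Fin 2) ℂ) (j l : Fin 4) :
    ∑ k, star (c j k) * c l k = ∑ k, star (c l k) * c j k := by
  have key : ∀ (G : Fin 4 → Fin 4 → Matrix (Fin 2) (Fin 2) ℂ)
      (_ : ∀ j k, (G j k).trace = if j = k then 2 else 0)
      (_ : ∑ i : (Fin 4 × Fin 4) × (Fin 4 × Fin 4),
        ((star (c i.1.1 i.2.1) * c i.1.2 i.2.2) • G i.1.1 i.1.2) ⊗ₖ G i.2.1 i.2.2 = 1),
      ∑ j, ∑ l, (∑ k, star (c j k) * c l k) • G j l = 1 := by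
    intro G hG hsum
    have := sum_trace_smul_eq_of_sum_kronecker_eq_one hsum
    rw [← this]
    simp only [Fintype.sum_prod_type, hG, Finset.sum_smul]
    refine Finset.sum_congr rfl fun j _ => Finset.sum_congr rfl fun l _ =>
      Finset.sum_congr rfl fun k _ => ?_
    rw [Finset.sum_eq_single k]
    · simp
    · intro m _ hm
      simp [hm.symm]
    · simp
  refine symm_of_sum_smul_quatBasis_eq_one (G := fun j l => ∑ k, star (c j k) * c l k)
    (key (fun j l => (quatBasis j).conjTranspose * quatBasis l) trace_quatBasis ?_)
    (key (fun j l => quatBasis l * (quatBasis j).conjTranspose)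
      (fun j k => (Matrix.trace_mul_comm _ _).trans (trace_quatBasis j k)) ?_) j l
  · rw [← (Matrix.mem_unitaryGroup_iff'.mp h), Matrix.star_eq_conjTranspose]
    simp only [Matrix.conjTranspose_sum, Matrix.sum_mul, Matrix.mul_sum, Matrix.conjTranspose_smul,
      Matrix.smul_mul, Matrix.mul_smul, Matrix.conjTranspose_kronecker, ← Matrix.mul_kronecker_mul,
      Fintype.sum_prod_type, Matrix.smul_kronecker, Finset.smul_sum, smul_smul]
    rw [Finset.sum_comm]
    refine Finset.sum_congr rfl fun l _ => ?_
    symm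
    rw [Finset.sum_comm]
    refine Finset.sum_congr rfl fun j _ => ?_
    rw [Finset.sum_comm]
    exact Finset.sum_congr rfl fun k _ => Finset.sum_congr rfl fun m _ => by rw [mul_comm]
  · rw [← (Matrix.mem_unitaryGroup_iff.mp h), Matrix.star_eq_conjTranspose]
    simp only [Matrix.conjTranspose_sum, Matrix.sum_mul, Matrix.mul_sum, Matrix.conjTranspose_smul,
      Matrix.smul_mul, Matrix.mul_smul, Matrix.conjTranspose_kronecker, ← Matrix.mul_kronecker_mul,
      Fintype.sum_prod_type, Matrix.smul_kronecker, Finset.smul_sum, smul_smul]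
    refine Finset.sum_congr rfl fun j _ => ?_
    rw [Finset.sum_comm]

/-- Every two-qubit unitary has an operator Schmidt decomposition into unitaries. -/
theorem exists_isOperatorSchmidt_unitary {U : Matrix (Fin 2 × Fin 2) (Fin 2 × Fin 2) ℂ}
    (hU : U ∈ Matrix.unitaryGroup (Fin 2 × Fin 2) ℂ) :
    ∃ (r : ℕ) (u : Fin r → ℝ) (L R : Fin r → Matrix (Fin 2) (Fin 2) ℂ),
      IsOperatorSchmidt U u L R ∧
      (∀ j, L j ∈ Matrix.unitaryGroup (Fin 2) ℂ) ∧
      (∀ j, R j ∈ Matrix.unitaryGroup (Fin 2) ℂ) := by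
  obtain ⟨C, hC⟩ : ∃ C : Matrix (Fin 4) (Fin 4) ℂ,
      U = ∑ j, ∑ k, C j k • (quatBasis j ⊗ₖ quatBasis k) := by
    -- Expand in the first tensor factor for fixed indices of the second, then expand the resulting
    -- coefficient matrices in the second factor.
    choose G hG using fun a' b' : Fin 2 =>
      exists_eq_sum_smul_quatBasis (Matrix.of fun a b => U (a, a') (b, b'))
    choose C hC using fun j => exists_eq_sum_smul_quatBasis (Matrix.of fun a' b' => G a' b' j)
    refine ⟨C, ?_⟩
    ext ⟨a, a'⟩ ⟨b, b'⟩
    have h1 := congrFun (congrFun (hG a' b') a) b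
    have h2 := fun j => congrFun (congrFun (hC j) a') b'
    simp only [Matrix.sum_apply, Matrix.smul_apply, Matrix.of_apply, smul_eq_mul,
      Matrix.kroneckerMap_apply] at h1 h2 ⊢
    simp only [h1, h2, Finset.sum_mul]
    exact Finset.sum_congr rfl fun j _ => Finset.sum_congr rfl fun k _ => by ring
  have h1 : C * C.conjTranspose = C.map star * C.transpose := by
    ext j l
    have := sum_star_mul_symm_of_unitary (hC ▸ hU) l j
    simpa [Matrix.mul_apply, mul_comm] using this
  have h2 : C.conjTranspose * C = C.transpose * C.map star := by
    ext j l
    -- Exchanging the qubits transposes C and preserves unitarity, which yields the reality of C†C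
    -- from that of CC†.
    have hsw : ∑ j, ∑ k, C k j • (quatBasis j ⊗ₖ quatBasis k) = U.submatrix Prod.swap Prod.swap := by
      rw [hC, Finset.sum_comm]
      ext p q
      simp [Matrix.sum_apply, mul_comm]
    have hswU : U.submatrix Prod.swap Prod.swap ∈ Matrix.unitaryGroup (Fin 2 × Fin 2) ℂ := by
      rw [Matrix.mem_unitaryGroup_iff', Matrix.star_eq_conjTranspose] at hU ⊢
      rw [Matrix.conjTranspose_submatrix,
        ← Matrix.submatrix_mul _ _ _ _ _ Prod.swap_bijective, hU]
      exact Matrix.submatrix_one _ Prod.swap_injective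
    have := sum_star_mul_symm_of_unitary (c := fun j k => C k j) (hsw ▸ hswU) j l
    simpa [Matrix.mul_apply, mul_comm] using this
  obtain ⟨r, σ, z, p, q, hσ, hz, hp, hq, hsum⟩ := Matrix.exists_real_singular_vectors h1 h2
  -- The phases are absorbed into the left factors, where they affect neither unitarity nor
  -- orthonormality.
  refine ⟨r, σ, fun j => z j • ∑ k, (p j k : ℂ) • quatBasis k,
    fun j => ∑ k, (q j k : ℂ) • quatBasis k, ⟨hσ, fun j k => ?_, fun j k => ?_, ?_⟩,
    fun j => smul_mem_unitaryGroup (hz j)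
      (sum_smul_quatBasis_mem_unitaryGroup (by rw [hp, if_pos rfl])),
    fun j => sum_smul_quatBasis_mem_unitaryGroup (by rw [hq, if_pos rfl])⟩
  · have h := hsInner_sum_smul_quatBasis (p j) (p k)
    rw [hp] at h
    rw [hsInner] at h ⊢
    rw [Matrix.conjTranspose_smul, Matrix.smul_mul, Matrix.mul_smul, smul_smul, Matrix.trace_smul,
      smul_eq_mul, mul_div_assoc, h]
    split_ifs with hjk
    · rw [← hjk, hz]; simp
    · simp
  · rw [hsInner_sum_smul_quatBasis, hq]
    split_ifs <;> simp
  · rw [hC]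
    ext x y
    simp only [Matrix.sum_apply, Matrix.smul_apply, Matrix.kroneckerMap_apply, smul_eq_mul, hsum,
      Finset.sum_mul, Finset.mul_sum]
    rw [Finset.sum_comm]
    symm
    rw [Finset.sum_comm]
    refine Finset.sum_congr rfl fun c _ => ?_
    rw [Finset.sum_comm]
    exact Finset.sum_congr rfl fun a _ => Finset.sum_congr rfl fun j _ => by ring

end TwoQubits

theorem mainTheorem1 :
    (∀ {A B J : Type*} [Fintype A] [DecidableEq A] [Nonempty A]
        [Fintype B] [DecidableEq B] [Nonempty B] [Fintype J] [DecidableEq J]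
        (U : Matrix (A × B) (A × B) ℂ) (u : J → ℝ) (L : J → Matrix A A ℂ) (R : J → Matrix B B ℂ),
        U ∈ Matrix.unitaryGroup (A × B) ℂ →
        IsOperatorSchmidt U u L R →
        (∀ j, L j ∈ Matrix.unitaryGroup A ℂ) →
        (∀ j, R j ∈ Matrix.unitaryGroup B ℂ) →
        quasiprobExtent (LOCCStar A B A B) (inducedMap U)
            = ENNReal.ofReal (2 * (∑ j, u j) ^ 2 - 1) ∧
        quasiprobExtent (LOStar A B A B) (inducedMap U)
            = ENNReal.ofReal (2 * (∑ j, u j) ^ 2 - 1)) ∧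
    (∀ U ∈ Matrix.unitaryGroup (Fin 2 × Fin 2) ℂ,
        ∃ (r : ℕ) (u : Fin r → ℝ) (L R : Fin r → Matrix (Fin 2) (Fin 2) ℂ),
          IsOperatorSchmidt U u L R ∧
          (∀ j, L j ∈ Matrix.unitaryGroup (Fin 2) ℂ) ∧
          (∀ j, R j ∈ Matrix.unitaryGroup (Fin 2) ℂ)) := by
  refine ⟨fun U u L R hU h hL hR => ?_, fun U hU => exists_isOperatorSchmidt_unitary hU⟩
  have hlow := h.le_quasiprobExtent_LOCCStar hU
  have hmid := quasiprobExtent_anti (LOStar_subset_LOCCStar (A := _) (B := _) (C := _) (D := _))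
    (inducedMap U)
  have hup := h.quasiprobExtent_LOStar_le hU hL hR
  -- The chain lower bound ≤ LOCC⋆ extent ≤ LO⋆ extent ≤ upper bound has equal ends.
  exact ⟨le_antisymm (hmid.trans hup) hlow, le_antisymm hup (hlow.trans hmid)⟩
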